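/- Let $F$ be a finite field with the discrete topology. Let $\mathcal{Q}$, $\mathcal{Q}_1$, $\mathcal{Q}_2$ be partitions of $\mathbb{Z}$ into (non-empty) finite intervals. For such a partition $\mathcal{Q}$ let $\sharp(\mathcal{Q}) = \{|\mathfrak{p}| : \mathfrak{p}\in\mathcal{Q}\}$ be the set of sizes of its blocks, and let $[\mathcal{Q}]$ be $\mathbb{Z}$ with the preorder: $m\lesssim_{\mathcal{Q}} n$ if $m<n$ or $m,n$ lie in a common block. A set $C\subseteq\mathbb{Z}$ is convex if $i,j\in C$ and $i\lesssim_{\mathcal{Q}}k\lesssim_{\mathcal{Q}}j$ imply $k\in C$. A matrix $(a_{ij})_{i,j\in\mathbb{Z}}$ over $F$ is nonsingular if there is a finite convex set $C_0$ such that $(a_{ij})_{i,j\in C}$ is invertible for every finite convex $C\supseteq C_0$. Let $\mathrm{U}_{[\mathcal{Q}]}(F)$ be the set of nonsingular matrices with $a_{ij}=0$ whenever $i\not\lesssim_{\mathcal{Q}}j$, and let $\mathrm{AU}_{[\mathcal{Q}]}(F)$ be the set of nonsingular matrices with $a_{ij}=0$ for all but finitely many pairs $(i,j)$ such that $i\not\lesssim_{\mathcal{Q}}j$;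 both are groups under matrix multiplication. $\mathrm{U}_{[\mathcal{Q}]}(F)$ carries the topology of entrywise convergence. For finite convex $C$ let $[\mathcal{Q}]+C$ be the preorder generated by $\lesssim_{\mathcal{Q}}$ together with the requirement that all elements of $C$ be equivalent; $\mathrm{AU}_{[\mathcal{Q}]}(F)$ is the union of the groups $\mathrm{U}_{[\mathcal{Q}]+C}(F)$, defined in the same way from $[\mathcal{Q}]+C$, and carries the direct limit topology: a subset is open if and only if its intersection with each $\mathrm{U}_{[\mathcal{Q}]+C}(F)$ is open in the topology of entrywise convergence. Two topological groups $G$ and $H$ are locally isomorphic if there are an open neighbourhood $V$ of the identity in $G$ and an open embedding $\varphi:V\to H$ that is compatible with the group operations as far as they are defined on $V$. (1) Let $n>1$, and $n>2$ if $|F|=3$. There is a continuous surjective homomorphism $\mathrm{U}_{[\mathcal{Q}]}(F)\to\mathrm{PGL}_n(F)$ if and only if $n\in\sharp(\mathcal{Q})$. (2) If $\mathrm{AU}_{[\mathcal{Q}_1]}(F)$ and $\mathrm{AU}_{[\mathcal{Q}_2]}(F)$ are locally isomorphic, then the symmetric difference $\sharp(\mathcal{Q}_1)\,\Delta\,\sharp(\mathcal{Q}_2)$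 is finite. -/

import Mathlib

set_option linter.unusedSectionVars false

namespace InfMatrix

section Preorders

variable {Λ : Type*}

/-- `i` is strictly below `j`: `i ≲ j` and not `i ∼ j`. -/
def StrictlyBelow (r : Λ → Λ → Prop) (i j : Λ) : Prop := r i j ∧ ¬ (r i j ∧ r j i)

/-- A set is convex if it contains `[i, j]` for all its elements `i, j`. -/
def IsConvex (r : Λ → Λ → Prop) (s : Set Λ) : Prop :=
  ∀ i ∈ s, ∀ j ∈ s, ∀ k, r i k → r k j → k ∈ s

/-- A set is strongly convex if each point outside lies strictly below all of it or strictly above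
all of it. -/
def IsStronglyConvex (r : Λ → Λ → Prop) (s : Set Λ) : Prop :=
  ∀ i, i ∉ s → (∀ j ∈ s, StrictlyBelow r i j) ∨ (∀ j ∈ s, StrictlyBelow r j i)

/-- A `ℤ`-like preorder: each finite set lies in a finite strongly convex set. -/
class IsZLike (r : Λ → Λ → Prop) : Prop extends IsPreorder Λ r where
  exists_stronglyConvex : ∀ s : Finset Λ, ∃ t : Finset Λ, s ⊆ t ∧ IsStronglyConvex r (t : Set Λ)

/-- The preorder `Λ + Λ'` generated by `≲` and by making all elements of `Λ' = s` equivalent. -/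
def adjoin (r : Λ → Λ → Prop) (s : Set Λ) : Λ → Λ → Prop :=
  Relation.ReflTransGen fun i j => r i j ∨ (i ∈ s ∧ j ∈ s)

theorem IsStronglyConvex.isConvex {r : Λ → Λ → Prop} {s : Set Λ} (h : IsStronglyConvex r s) :
    IsConvex r s := by
  intro i hi j hj k hik hkj
  by_contra hk
  rcases h k hk with h | h
  · exact (h i hi).2 ⟨(h i hi).1, hik⟩
  · exact (h j hj).2 ⟨(h j hj).1, hkj⟩

theorem exists_convex (r : Λ → Λ → Prop) [IsZLike r] (s : Finset Λ) :
    ∃ t : Finset Λ, s ⊆ t ∧ IsConvex r (t : Set Λ) :=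
  (IsZLike.exists_stronglyConvex (r := r) s).imp fun _ h => ⟨h.1, h.2.isConvex⟩

theorem adjoin_iff (r : Λ → Λ → Prop) [IsPreorder Λ r] (s : Set Λ) (i j : Λ) :
    adjoin r s i j ↔ r i j ∨ ∃ x ∈ s, ∃ y ∈ s, r i x ∧ r y j := by
  constructor
  · intro h
    induction h with
    | refl => exact Or.inl (refl_of r i)
    | tail _ h ih =>
      rcases ih with ih | ⟨x, hx, y, hy, h1, h2⟩
      · rcases h with h | ⟨h, h'⟩
        · exact Or.inl (trans_of r ih h)
        · exact Or.inr ⟨_, h, _, h', ih, refl_of r _⟩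
      · rcases h with h | ⟨h, h'⟩
        · exact Or.inr ⟨x, hx, y, hy, h1, trans_of r h2 h⟩
        · exact Or.inr ⟨x, hx, _, h', h1, refl_of r _⟩
  · rintro (h | ⟨x, hx, y, hy, h1, h2⟩)
    · exact Relation.ReflTransGen.single (Or.inl h)
    · exact .trans (.single (Or.inl h1)) (.trans (.single (Or.inr ⟨hx, hy⟩)) (.single (Or.inl h2)))

theorem adjoin_isZLike (r : Λ → Λ → Prop) [IsZLike r] (s : Finset Λ) :
    IsZLike (adjoin r (s : Set Λ)) where
  refl _ := Relation.ReflTransGen.refl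
  trans _ _ _ := Relation.ReflTransGen.trans
  exists_stronglyConvex := by
    classical
    intro u
    obtain ⟨t, ht, hc⟩ := IsZLike.exists_stronglyConvex (r := r) (u ∪ s)
    refine ⟨t, Finset.union_subset_left ht, fun i hi => ?_⟩
    have hs : ∀ x ∈ s, x ∈ t := fun x hx => ht (Finset.mem_union_right _ hx)
    refine (hc i hi).imp (fun h j hj => ?_) (fun h j hj => ?_)
    · refine ⟨(adjoin_iff r _ _ _).2 (Or.inl (h j hj).1), fun h' => ?_⟩
      rcases (adjoin_iff r _ _ _).1 h'.2 with h2 | ⟨x, hx, y, hy, h1, h2⟩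
      · exact (h j hj).2 ⟨(h j hj).1, h2⟩
      · exact (h y (hs y hy)).2 ⟨(h y (hs y hy)).1, h2⟩
    · refine ⟨(adjoin_iff r _ _ _).2 (Or.inl (h j hj).1), fun h' => ?_⟩
      rcases (adjoin_iff r _ _ _).1 h'.2 with h2 | ⟨x, hx, y, hy, h1, h2⟩
      · exact (h j hj).2 ⟨(h j hj).1, h2⟩
      · exact (h x (hs x hx)).2 ⟨(h x (hs x hx)).1, h1⟩

end Preorders

section Matrices

variable {Λ : Type*} {R : Type*} [CommRing R]

/-- The product of `(Λ × Λ)`-matrices. It is only used where each sum has finitely many nonzero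
terms. -/
noncomputable def mul (a b : Matrix Λ Λ R) : Matrix Λ Λ R :=
  fun i j => ∑ᶠ k, a i k * b k j

/-- The `(t × t)`-submatrix, for a finite set `t` of indices. -/
def restrict (a : Matrix Λ Λ R) (t : Finset Λ) : Matrix t t R :=
  a.submatrix Subtype.val Subtype.val

/-- `a` is nonsingular: its submatrices on all sufficiently large finite convex sets are
invertible. -/
def IsNonsingular [DecidableEq Λ] (r : Λ → Λ → Prop) (a : Matrix Λ Λ R) : Prop :=
  ∃ t₀ : Finset Λ, IsConvex r (t₀ : Set Λ) ∧
    ∀ t : Finset Λ, IsConvex r (t : Set Λ) → t₀ ⊆ t → IsUnit (restrict a t)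

def IsUpperTriangular (r : Λ → Λ → Prop) (a : Matrix Λ Λ R) : Prop :=
  ∀ i j, ¬ r i j → a i j = 0

def IsAlmostUpperTriangular (r : Λ → Λ → Prop) (a : Matrix Λ Λ R) : Prop :=
  {p : Λ × Λ | ¬ r p.1 p.2 ∧ a p.1 p.2 ≠ 0}.Finite

/-- `U_Λ(R)`: the nonsingular upper triangular matrices. -/
def U [DecidableEq Λ] (r : Λ → Λ → Prop) (R : Type*) [CommRing R] : Type _ :=
  {a : Matrix Λ Λ R // IsUpperTriangular r a ∧ IsNonsingular r a}

/-- `AU_Λ(R)`: the nonsingular almost upper triangular matrices. -/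
def AU [DecidableEq Λ] (r : Λ → Λ → Prop) (R : Type*) [CommRing R] : Type _ :=
  {a : Matrix Λ Λ R // IsAlmostUpperTriangular r a ∧ IsNonsingular r a}

section Products

variable {r : Λ → Λ → Prop} [IsZLike r]

theorem interval_finite (r : Λ → Λ → Prop) [IsZLike r] (i j : Λ) : {k | r i k ∧ r k j}.Finite := by
  classical
  obtain ⟨t, ht, hc⟩ := exists_convex r ({i, j} : Finset Λ)
  refine t.finite_toSet.subset fun k hk => hc i (ht (by simp)) j (ht (by simp)) k hk.1 hk.2


theorem mul_term_eq_zero {a b : Matrix Λ Λ R} (ha : IsUpperTriangular r a)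
    (hb : IsUpperTriangular r b) (i j k : Λ) (h : ¬ (r i k ∧ r k j)) : a i k * b k j = 0 := by
  by_cases h1 : r i k
  · rw [hb k j fun h2 => h ⟨h1, h2⟩, mul_zero]
  · rw [ha i k h1, zero_mul]

theorem mul_upper {a b : Matrix Λ Λ R} (ha : IsUpperTriangular r a)
    (hb : IsUpperTriangular r b) : IsUpperTriangular r (mul a b) := by
  intro i j hij
  refine finsum_eq_zero_of_forall_eq_zero fun k => mul_term_eq_zero ha hb i j k ?_
  exact fun h => hij (trans_of r h.1 h.2)

theorem restrict_mul {a b : Matrix Λ Λ R} (ha : IsUpperTriangular r a)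
    (hb : IsUpperTriangular r b) {t : Finset Λ} (ht : IsConvex r (t : Set Λ)) :
    restrict (mul a b) t = restrict a t * restrict b t := by
  ext i j
  simp only [restrict, Matrix.submatrix_apply, Matrix.mul_apply, mul]
  rw [finsum_eq_sum_of_support_subset (s := t)]
  · exact (Finset.sum_coe_sort t fun k => a i k * b k j).symm
  · intro k hk
    by_contra hkt
    exact hk (mul_term_eq_zero ha hb i j k fun h => hkt (ht i i.2 j j.2 k h.1 h.2))

variable (r) in
theorem eq_of_restrict {a b : Matrix Λ Λ R} (t₀ : Finset Λ)
    (h : ∀ t : Finset Λ, IsConvex r (t : Set Λ) → t₀ ⊆ t → restrict a t = restrict b t) :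
    a = b := by
  classical
  ext i j
  obtain ⟨t, ht, hc⟩ := exists_convex r (t₀ ∪ {i, j})
  have := congrFun (congrFun (h t hc (Finset.union_subset_left ht)) ⟨i, ht (by simp)⟩)
    ⟨j, ht (by simp)⟩
  exact this

theorem mul_assoc_upper {a b c : Matrix Λ Λ R} (ha : IsUpperTriangular r a)
    (hb : IsUpperTriangular r b) (hc : IsUpperTriangular r c) :
    mul (mul a b) c = mul a (mul b c) :=
  eq_of_restrict r ∅ fun t ht _ => by
    rw [restrict_mul (mul_upper ha hb) hc ht, restrict_mul ha hb ht,
      restrict_mul ha (mul_upper hb hc) ht, restrict_mul hb hc ht, mul_assoc]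

variable [DecidableEq Λ]

theorem restrict_one (t : Finset Λ) : restrict (1 : Matrix Λ Λ R) t = 1 := by
  exact Matrix.submatrix_one _ Subtype.val_injective

theorem one_mul' (a : Matrix Λ Λ R) : mul 1 a = a := by
  ext i j
  rw [mul, finsum_eq_single _ i]
  · simp
  · intro k hk
    simp [Matrix.one_apply_ne hk.symm]

theorem mul_one' (a : Matrix Λ Λ R) : mul a 1 = a := by
  ext i j
  rw [mul, finsum_eq_single _ j]
  · simp
  · intro k hk
    simp [Matrix.one_apply_ne hk]

theorem one_upper : IsUpperTriangular r (1 : Matrix Λ Λ R) := by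
  intro i j h
  refine Matrix.one_apply_ne ?_
  rintro rfl
  exact h (refl_of r i)

variable (r) in
theorem one_nonsingular : IsNonsingular r (1 : Matrix Λ Λ R) :=
  ⟨∅, by intro i hi; simp at hi, fun t _ _ => by rw [restrict_one]; exact isUnit_one⟩

theorem mul_nonsingular {a b : Matrix Λ Λ R} (ha : IsUpperTriangular r a)
    (hb : IsUpperTriangular r b) (ha' : IsNonsingular r a) (hb' : IsNonsingular r b) :
    IsNonsingular r (mul a b) := by
  obtain ⟨s, -, hs⟩ := ha'
  obtain ⟨t, -, ht⟩ := hb'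
  obtain ⟨u, hu, hc⟩ := exists_convex r (s ∪ t)
  refine ⟨u, hc, fun v hv huv => ?_⟩
  rw [restrict_mul ha hb hv]
  exact (hs v hv ((Finset.union_subset_left hu).trans huv)).mul
    (ht v hv ((Finset.union_subset_right hu).trans huv))

/-- The inverse of a finite invertible upper triangular matrix is upper triangular. -/
theorem inv_upper_finite {ι : Type*} [Fintype ι] [DecidableEq ι] (q : ι → ι → Prop)
    (hrefl : ∀ i, q i i) (htrans : ∀ i j k, q i j → q j k → q i k)
    (A : Matrix ι ι R) (hA : IsUpperTriangular q A) (hu : IsUnit A) :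
    IsUpperTriangular q A⁻¹ := by
  have hpow : ∀ n : ℕ, IsUpperTriangular q (A ^ n) := by
    intro n
    induction n with
    | zero =>
      intro i j h
      rw [pow_zero]
      refine Matrix.one_apply_ne ?_
      rintro rfl
      exact h (hrefl i)
    | succ n ih =>
      intro i j h
      rw [pow_succ, Matrix.mul_apply]
      refine Finset.sum_eq_zero fun k _ => ?_
      by_cases h1 : q i k
      · rw [hA k j fun h2 => h (htrans _ _ _ h1 h2), mul_zero]
      · rw [ih i k h1, zero_mul]
  have haeval : ∀ p : Polynomial R, IsUpperTriangular q (Polynomial.aeval A p) := by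
    intro p i j h
    rw [Polynomial.aeval_eq_sum_range, Matrix.sum_apply]
    refine Finset.sum_eq_zero fun n _ => ?_
    rw [Matrix.smul_apply, hpow n i j h, smul_zero]
  have hch := Matrix.aeval_self_charpoly A
  rw [← Polynomial.divX_mul_X_add A.charpoly, map_add, map_mul, Polynomial.aeval_X,
    Polynomial.aeval_C] at hch
  have hdet : IsUnit (A.charpoly.coeff 0) := by
    have h1 := (Matrix.isUnit_iff_isUnit_det A).1 hu
    rw [Matrix.det_eq_sign_charpoly_coeff] at h1
    exact isUnit_of_mul_isUnit_right h1
  obtain ⟨c, hc⟩ := hdet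
  have hinv : A⁻¹ = (-(↑c⁻¹ : R)) • Polynomial.aeval A A.charpoly.divX := by
    refine Matrix.inv_eq_left_inv ?_
    rw [smul_mul_assoc, eq_neg_of_add_eq_zero_left hch, ← hc, Algebra.algebraMap_eq_smul_one,
      smul_neg, neg_smul, neg_neg, smul_smul, Units.inv_mul, one_smul]
  intro i j h
  rw [hinv, Matrix.smul_apply, haeval _ i j h, smul_zero]

theorem exists_inverse {a : Matrix Λ Λ R} (ha : IsUpperTriangular r a)
    (ha' : IsNonsingular r a) :
    ∃ b : Matrix Λ Λ R, IsUpperTriangular r b ∧ IsNonsingular r b ∧ mul a b = 1 ∧ mul b a = 1 := by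
  obtain ⟨t₀, -, h₀⟩ := ha'
  let B : Finset Λ → Matrix Λ Λ R := fun t i j =>
    if h : i ∈ t ∧ j ∈ t then (restrict a t)⁻¹ ⟨i, h.1⟩ ⟨j, h.2⟩ else 0
  have hBr : ∀ t, restrict (B t) t = (restrict a t)⁻¹ := by
    intro t
    ext i j
    exact dif_pos ⟨i.2, j.2⟩
  have hBu : ∀ t : Finset Λ, IsConvex r (t : Set Λ) → t₀ ⊆ t → IsUpperTriangular r (B t) := by
    intro t ht h0 i j hij
    by_cases h : i ∈ t ∧ j ∈ t
    · simp only [B, dif_pos h]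
      refine inv_upper_finite (fun x y : t => r x y) (fun x => refl_of r _)
        (fun x y z hxy hyz => trans_of r hxy hyz) (restrict a t) (fun x y hxy => ha x y hxy)
        (h₀ t ht h0) ⟨i, h.1⟩ ⟨j, h.2⟩ hij
    · simp only [B, dif_neg h]
  have hcons : ∀ s t : Finset Λ, IsConvex r (s : Set Λ) → IsConvex r (t : Set Λ) → t₀ ⊆ s → s ⊆ t →
      restrict (B t) s = (restrict a s)⁻¹ := by
    intro s t hs ht h0 hst
    refine (Matrix.inv_eq_right_inv ?_).symm
    rw [← restrict_mul ha (hBu t ht (h0.trans hst)) hs]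
    have h1 : restrict (mul a (B t)) t = 1 := by
      rw [restrict_mul ha (hBu t ht (h0.trans hst)) ht, hBr]
      exact Matrix.mul_nonsing_inv _
        ((Matrix.isUnit_iff_isUnit_det _).1 (h₀ t ht (h0.trans hst)))
    ext i j
    have h2 := congrFun (congrFun h1 ⟨i, hst i.2⟩) ⟨j, hst j.2⟩
    rw [← restrict_one] at h2 ⊢
    exact h2
  choose T hT hTc using fun s : Finset Λ => exists_convex r (t₀ ∪ s)
  have hT0 : ∀ s, t₀ ⊆ T s := fun s => Finset.union_subset_left (hT s)
  have hTs : ∀ s, s ⊆ T s := fun s => Finset.union_subset_right (hT s)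
  let b : Matrix Λ Λ R := fun i j => B (T {i, j}) i j
  have hbu : IsUpperTriangular r b := fun i j hij => hBu _ (hTc _) (hT0 _) i j hij
  have hb : ∀ t : Finset Λ, IsConvex r (t : Set Λ) → t₀ ⊆ t →
      restrict b t = (restrict a t)⁻¹ := by
    intro t ht h0
    ext i j
    let s : Finset Λ := T {i.1, j.1}
    let u : Finset Λ := T (s ∪ t)
    have hsu : s ⊆ u := Finset.union_subset_left (hTs (s ∪ t))
    have htu : t ⊆ u := Finset.union_subset_right (hTs (s ∪ t))
    have hi : i.1 ∈ s := hTs _ (by simp)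
    have hj : j.1 ∈ s := hTs _ (by simp)
    have e1 := hcons s u (hTc _) (hTc _) (hT0 _) hsu
    have e2 := hcons t u ht (hTc _) h0 htu
    rw [← hBr s] at e1
    have e1' : B u i.1 j.1 = B s i.1 j.1 := congrFun (congrFun e1 ⟨i.1, hi⟩) ⟨j.1, hj⟩
    have e2' : B u i.1 j.1 = (restrict a t)⁻¹ i j := congrFun (congrFun e2 i) j
    exact e1'.symm.trans e2'
  have hd : ∀ t : Finset Λ, IsConvex r (t : Set Λ) → t₀ ⊆ t → IsUnit (restrict a t).det :=
    fun t ht h0 => (Matrix.isUnit_iff_isUnit_det _).1 (h₀ t ht h0)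
  refine ⟨b, hbu, ⟨T ∅, hTc _, fun t ht h0 => ?_⟩, ?_, ?_⟩
  · rw [hb t ht ((hT0 _).trans h0)]
    exact Matrix.isUnit_nonsing_inv_iff.2 (h₀ t ht ((hT0 _).trans h0))
  · refine eq_of_restrict r t₀ fun t ht h0 => ?_
    rw [restrict_mul ha hbu ht, hb t ht h0, restrict_one, Matrix.mul_nonsing_inv _ (hd t ht h0)]
  · refine eq_of_restrict r t₀ fun t ht h0 => ?_
    rw [restrict_mul hbu ha ht, hb t ht h0, restrict_one, Matrix.nonsing_inv_mul _ (hd t ht h0)]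

/-- `U_{Λ+Λ'}(R) ⊆ AU_Λ(R)`. -/
theorem almostUpper_of_adjoin {a : Matrix Λ Λ R} (s : Finset Λ)
    (ha : IsUpperTriangular (adjoin r (s : Set Λ)) a)
    (ha' : IsNonsingular (adjoin r (s : Set Λ)) a) :
    IsAlmostUpperTriangular r a ∧ IsNonsingular r a := by
  constructor
  · obtain ⟨t, ht, hc⟩ := IsZLike.exists_stronglyConvex (r := r) s
    refine (t ×ˢ t).finite_toSet.subset ?_
    rintro ⟨i, j⟩ ⟨hij, hne⟩
    have h : adjoin r (s : Set Λ) i j := by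
      by_contra h
      exact hne (ha i j h)
    rcases (adjoin_iff r _ _ _).1 h with h | ⟨x, hx, y, hy, h1, h2⟩
    · exact absurd h hij
    · simp only [Finset.coe_product, Set.mem_prod, Finset.mem_coe]
      constructor
      · by_contra hi
        rcases hc i hi with h | h
        · exact hij (trans_of r (h y (ht hy)).1 h2)
        · exact (h x (ht hx)).2 ⟨(h x (ht hx)).1, h1⟩
      · by_contra hj
        rcases hc j hj with h | h
        · exact (h y (ht hy)).2 ⟨(h y (ht hy)).1, h2⟩
        · exact hij (trans_of r h1 (h x (ht hx)).1)
  · obtain ⟨t₀, -, h₀⟩ := ha'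
    obtain ⟨u, hu, hc⟩ := exists_convex r (s ∪ t₀)
    refine ⟨u, hc, fun t ht hut => h₀ t ?_ ((Finset.union_subset_right hu).trans hut)⟩
    have hs : ∀ x ∈ s, x ∈ t := fun x hx => hut (hu (Finset.mem_union_left _ hx))
    intro i hi j hj k hik hkj
    rcases (adjoin_iff r _ _ _).1 hik with h | ⟨x, hx, y, hy, h1, h2⟩ <;>
      rcases (adjoin_iff r _ _ _).1 hkj with h' | ⟨x', hx', y', hy', h1', h2'⟩
    · exact ht i hi j hj k h h'
    · exact ht i hi x' (hs _ hx') k h h1'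
    · exact ht y (hs _ hy) j hj k h2 h'
    · exact ht y (hs _ hy) x' (hs _ hx') k h2 h1'

theorem upper_adjoin_mono {a : Matrix Λ Λ R} {s t : Finset Λ} (hst : s ⊆ t)
    (ha : IsUpperTriangular (adjoin r (s : Set Λ)) a) :
    IsUpperTriangular (adjoin r (t : Set Λ)) a := by
  intro i j h
  refine ha i j fun h' => h (Relation.ReflTransGen.mono (r := fun i j => r i j ∨ (i ∈ (s : Set Λ) ∧ j ∈ (s : Set Λ)))
    ?_ i j h')
  exact fun x y hxy => hxy.imp id fun h => ⟨hst h.1, hst h.2⟩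

theorem nonsingular_adjoin {a : Matrix Λ Λ R} (s : Finset Λ) (ha : IsNonsingular r a) :
    IsNonsingular (adjoin r (s : Set Λ)) a := by
  obtain ⟨t₀, -, h₀⟩ := ha
  have := adjoin_isZLike r s
  obtain ⟨u, hu, hc⟩ := exists_convex (adjoin r (s : Set Λ)) t₀
  refine ⟨u, hc, fun t ht hut => h₀ t ?_ (hu.trans hut)⟩
  intro i hi j hj k hik hkj
  exact ht i hi j hj k (.single (Or.inl hik)) (.single (Or.inl hkj))

theorem exists_upper_adjoin {a : Matrix Λ Λ R} (ha : IsAlmostUpperTriangular r a) :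
    ∃ s : Finset Λ, IsUpperTriangular (adjoin r (s : Set Λ)) a := by
  let v := ha.toFinset
  refine ⟨v.image Prod.fst ∪ v.image Prod.snd, fun i j h => ?_⟩
  by_contra hne
  have hij : ¬ r i j := fun h' => h (.single (Or.inl h'))
  have hv : (i, j) ∈ v := ha.mem_toFinset.2 ⟨hij, hne⟩
  refine h (.single (Or.inr ⟨?_, ?_⟩))
  · exact Finset.mem_union_left _ (Finset.mem_image.2 ⟨_, hv, rfl⟩)
  · exact Finset.mem_union_right _ (Finset.mem_image.2 ⟨_, hv, rfl⟩)

end Products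

section Groups

variable [DecidableEq Λ] (r : Λ → Λ → Prop) [IsZLike r]

/-- `U_Λ(R)` is a group under matrix multiplication. -/
noncomputable instance : Group (U r R) where
  mul a b := ⟨mul a.1 b.1, mul_upper a.2.1 b.2.1, mul_nonsingular a.2.1 b.2.1 a.2.2 b.2.2⟩
  one := ⟨1, one_upper, one_nonsingular r⟩
  inv a := ⟨(exists_inverse a.2.1 a.2.2).choose, (exists_inverse a.2.1 a.2.2).choose_spec.1,
    (exists_inverse a.2.1 a.2.2).choose_spec.2.1⟩
  mul_assoc a b c := Subtype.ext (mul_assoc_upper a.2.1 b.2.1 c.2.1)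
  one_mul a := Subtype.ext (one_mul' a.1)
  mul_one a := Subtype.ext (mul_one' a.1)
  inv_mul_cancel a := Subtype.ext (exists_inverse a.2.1 a.2.2).choose_spec.2.2.2

/-- The inclusion of `U_{Λ+Λ'}(R)` in `AU_Λ(R)`. -/
def inclusion (s : Finset Λ) (a : U (adjoin r (s : Set Λ)) R) : AU r R :=
  ⟨a.1, almostUpper_of_adjoin s a.2.1 a.2.2⟩

variable {r}

theorem AU.exists_common (a b c : AU r R) : ∃ s : Finset Λ,
    IsUpperTriangular (adjoin r (s : Set Λ)) a.1 ∧ IsUpperTriangular (adjoin r (s : Set Λ)) b.1 ∧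
    IsUpperTriangular (adjoin r (s : Set Λ)) c.1 := by
  obtain ⟨s, hs⟩ := exists_upper_adjoin a.2.1
  obtain ⟨t, ht⟩ := exists_upper_adjoin b.2.1
  obtain ⟨u, hu⟩ := exists_upper_adjoin c.2.1
  refine ⟨s ∪ t ∪ u, upper_adjoin_mono ?_ hs, upper_adjoin_mono ?_ ht, upper_adjoin_mono ?_ hu⟩
  · exact Finset.subset_union_left.trans Finset.subset_union_left
  · exact Finset.subset_union_right.trans Finset.subset_union_left
  · exact Finset.subset_union_right

theorem AU.mul_mem (a b : AU r R) :
    IsAlmostUpperTriangular r (mul a.1 b.1) ∧ IsNonsingular r (mul a.1 b.1) := by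
  obtain ⟨s, ha, hb, -⟩ := AU.exists_common a b a
  have := adjoin_isZLike r s
  exact almostUpper_of_adjoin s (mul_upper ha hb)
    (mul_nonsingular ha hb (nonsingular_adjoin s a.2.2) (nonsingular_adjoin s b.2.2))

theorem AU.mul_assoc' (a b c : AU r R) : mul (mul a.1 b.1) c.1 = mul a.1 (mul b.1 c.1) := by
  obtain ⟨s, ha, hb, hc⟩ := AU.exists_common a b c
  have := adjoin_isZLike r s
  exact mul_assoc_upper ha hb hc

theorem AU.one_mem : IsAlmostUpperTriangular r (1 : Matrix Λ Λ R) ∧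
    IsNonsingular r (1 : Matrix Λ Λ R) := by
  refine ⟨?_, one_nonsingular r⟩
  refine Set.finite_empty.subset fun p hp => ?_
  exact hp.2 (one_upper p.1 p.2 hp.1)

theorem AU.exists_inv (a : AU r R) : ∃ b : AU r R, mul b.1 a.1 = 1 := by
  obtain ⟨s, ha, -⟩ := AU.exists_common a a a
  have := adjoin_isZLike r s
  obtain ⟨b, hb, hb', -, h⟩ := exists_inverse ha (nonsingular_adjoin s a.2.2)
  exact ⟨⟨b, almostUpper_of_adjoin s hb hb'⟩, h⟩

/-- `AU_Λ(R)` is a group under matrix multiplication. -/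
noncomputable instance : Group (AU r R) where
  mul a b := ⟨mul a.1 b.1, AU.mul_mem a b⟩
  one := ⟨1, AU.one_mem⟩
  inv a := (AU.exists_inv a).choose
  mul_assoc a b c := Subtype.ext (AU.mul_assoc' a b c)
  one_mul a := Subtype.ext (one_mul' a.1)
  mul_one a := Subtype.ext (mul_one' a.1)
  inv_mul_cancel a := Subtype.ext (AU.exists_inv a).choose_spec

end Groups

section Topology

variable [DecidableEq Λ] (r : Λ → Λ → Prop) [TopologicalSpace R]

/-- The topology of entrywise convergence on `U_Λ(R)`. -/
instance : TopologicalSpace (U r R) :=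
  TopologicalSpace.induced Subtype.val inferInstance

/-- The direct limit topology on `AU_Λ(R) = lim U_{Λ+Λ'}(R)`, with `Λ'` ranging over the finite
convex sets: a set is open iff its intersection with each `U_{Λ+Λ'}(R)` is open there. For discrete
`R` it is the group topology for which all these inclusions are continuous and open. -/
instance [IsZLike r] : TopologicalSpace (AU r R) :=
  ⨆ s : {s : Finset Λ // IsConvex r (s : Set Λ)},
    TopologicalSpace.coinduced (inclusion r s.1) inferInstance

end Topology

end Matrices

section Partitions

/-- A partition of `ℤ` into finite intervals. -/
structure IntervalPartition where
  parts : Set (Set ℤ)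
  isPartition : Setoid.IsPartition parts
  isInterval : ∀ p ∈ parts, ∃ m n : ℤ, p = Set.Icc m n

namespace IntervalPartition

variable (Q : IntervalPartition)

/-- `m ≲_Q n` if `m < n` or `m, n` lie in a common part. -/
def rel (m n : ℤ) : Prop := m < n ∨ ∃ p ∈ Q.parts, m ∈ p ∧ n ∈ p

/-- The set of sizes of parts. -/
def sizes : Set ℕ := {n | ∃ p ∈ Q.parts, p.ncard = n}

variable {Q} in
theorem part_eq {p q : Set ℤ} (hp : p ∈ Q.parts) (hq : q ∈ Q.parts) {m : ℤ} (hmp : m ∈ p)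
    (hmq : m ∈ q) : p = q :=
  (Q.isPartition.2 m).unique ⟨hp, hmp⟩ ⟨hq, hmq⟩

instance : IsZLike Q.rel where
  refl m := by
    obtain ⟨p, ⟨hp, hm⟩, -⟩ := Q.isPartition.2 m
    exact Or.inr ⟨p, hp, hm, hm⟩
  trans := by
    rintro a b c (h | ⟨p, hp, ha, hb⟩) (h' | ⟨q, hq, hb', hc⟩)
    · exact Or.inl (h.trans h')
    · by_cases hac : a < c
      · exact Or.inl hac
      · obtain ⟨m, n, rfl⟩ := Q.isInterval q hq
        simp only [Set.mem_Icc] at hb' hc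
        exact Or.inr ⟨_, hq, ⟨by omega, by omega⟩, hc⟩
    · by_cases hac : a < c
      · exact Or.inl hac
      · obtain ⟨m, n, rfl⟩ := Q.isInterval p hp
        simp only [Set.mem_Icc] at ha hb
        exact Or.inr ⟨_, hp, ha, ⟨by omega, by omega⟩⟩
    · obtain rfl := part_eq hp hq hb hb'
      exact Or.inr ⟨_, hp, ha, hc⟩
  exists_stronglyConvex := by
    intro s
    obtain ⟨A, hA⟩ := s.bddBelow
    obtain ⟨B, hB⟩ := s.bddAbove
    obtain ⟨p, ⟨hp, hAp⟩, -⟩ := Q.isPartition.2 (min A B)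
    obtain ⟨q, ⟨hq, hBq⟩, -⟩ := Q.isPartition.2 (max A B)
    obtain ⟨m, m', rfl⟩ := Q.isInterval p hp
    obtain ⟨n', n, rfl⟩ := Q.isInterval q hq
    have hA' : m ≤ min A B := hAp.1
    have hB' : max A B ≤ n := hBq.2
    refine ⟨Finset.Icc m n, fun x hx => ?_, fun i hi => ?_⟩
    · have h1 : A ≤ x := hA hx
      have h2 : x ≤ B := hB hx
      exact Finset.mem_Icc.2 ⟨by omega, by omega⟩
    · simp only [Finset.coe_Icc, Set.mem_Icc] at hi ⊢
      by_cases him : i < m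
      · refine Or.inl fun j hj => ⟨Or.inl (by omega), ?_⟩
        rintro ⟨-, h | ⟨p', hp', hj', hi'⟩⟩
        · omega
        · obtain ⟨x, y, rfl⟩ := Q.isInterval p' hp'
          simp only [Set.mem_Icc] at hj' hi' hAp
          have e := part_eq hp hp' (m := m) ⟨by omega, by omega⟩ ⟨by omega, by omega⟩
          have hx : i ∈ Set.Icc m m' := e ▸ ⟨by omega, by omega⟩
          exact absurd hx.1 (by omega)
      · refine Or.inr fun j hj => ⟨Or.inl (by omega), ?_⟩
        rintro ⟨-, h | ⟨p', hp', hi', hj'⟩⟩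
        · omega
        · obtain ⟨x, y, rfl⟩ := Q.isInterval p' hp'
          simp only [Set.mem_Icc] at hj' hi' hBq
          have e := part_eq hq hp' (m := n) ⟨by omega, by omega⟩ ⟨by omega, by omega⟩
          have hx : i ∈ Set.Icc n' n := e ▸ ⟨by omega, by omega⟩
          exact absurd hx.2 (by omega)

end IntervalPartition

end Partitions

/-- The quotient topology on `PGL(n, R)`; it is discrete if `R` is. -/
instance {n R : Type*} [Fintype n] [DecidableEq n] [CommRing R] [TopologicalSpace R] :
    TopologicalSpace (Matrix.ProjGenLinGroup n R) :=
  TopologicalSpace.coinduced Matrix.ProjGenLinGroup.mk inferInstance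

/-- `G` and `H` are locally isomorphic: there is an open embedding into `H` of an open neighbourhood
of the identity in `G` that is compatible with the group operations as far as they are defined. -/
def LocallyIsomorphic (G H : Type*) [Group G] [TopologicalSpace G] [Group H] [TopologicalSpace H] :
    Prop :=
  ∃ (V : Set G) (φ : V → H), IsOpen V ∧ (1 : G) ∈ V ∧ Topology.IsOpenEmbedding φ ∧
    (∀ (x y : V) (h : (x * y : G) ∈ V), φ ⟨x * y, h⟩ = φ x * φ y) ∧
    (∀ (x : V) (h : (x⁻¹ : G) ∈ V), φ ⟨(x : G)⁻¹, h⟩ = (φ x)⁻¹)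

end InfMatrix

/-! A surjection onto `PGL_n` must see a diagonal block of size exactly `n`. Consider the congruence
subgroup of matrices trivial on a finite convex set `C`, and a homomorphism depending only on a
finite convex window `D`. Modulo matrices unitriangular on the window, which are `p`-torsion there
(`p` the characteristic), this subgroup is generated by the commuting groups `GL_m` of the parts in
`D` disjoint from `C`. Suppose no part has size `n`. If `m > n`, the map from `GL_m` has noncentral
kernel for reasons of order; since `m ≥ 3`, that kernel contains all transvections and the image is
abelian. If `m < n` and `n ≥ 3`, a normal image is too small to be a nontrivial normal subgroup of
`PGL_n`; if `n = 2`, then `m = 1`. So the image is trivial for `n ≥ 3`, and has only `p`-torsion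
commutators for `n = 2`, which `PGL_2` does not. This is `image_of_notMem_sizes`; with `C` empty it
gives the nontrivial half of (1), while the block of a part of size `n` gives the other half.

For (2), the group `U` is open in `AU`, so a local isomorphism restricts to a topological
isomorphism between open subgroups of the two groups `U`. If `n` is large and a size for the second
partition only, a block of size `n` yields a surjection onto `PGL_n` from an open subgroup of the
first group. It is trivial on a congruence subgroup chosen independently of `n`, so the order of
`PGL_n` is bounded, and hence so is `n`. -/

namespace InfMatrix

open Matrix

/-! ### Noncentral normal subgroups of `GL` contain all transvections -/

section NormalSubgroups

variable {ι F : Type*} [Fintype ι] [DecidableEq ι] [Field F]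

/-- The transvection `x ↦ x + (φ ⬝ᵥ x) • w`, for `φ ⬝ᵥ w = 0`. -/
def rankOneGL (w φ : ι → F) (h : φ ⬝ᵥ w = 0) : GL ι F where
  val := 1 + vecMulVec w φ
  inv := 1 - vecMulVec w φ
  val_inv := by
    have : vecMulVec w φ * vecMulVec w φ = 0 := by
      simp [vecMulVec_mul_vecMulVec, h]
    rw [add_mul, mul_sub, mul_sub, this]; simp
  inv_val := by
    have : vecMulVec w φ * vecMulVec w φ = 0 := by
      simp [vecMulVec_mul_vecMulVec, h]
    rw [sub_mul, mul_add, mul_add, this]; simp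

/-- The elementary transvection `transvection i j c` as an element of `GL`. -/
def transvGL (i j : ι) (hij : i ≠ j) (c : F) : GL ι F where
  val := transvection i j c
  inv := transvection i j (-c)
  val_inv := by rw [transvection_mul_transvection_same _ _ hij]; simp
  inv_val := by rw [transvection_mul_transvection_same _ _ hij]; simp

theorem transvection_eq (i j : ι) (c : F) :
    transvection i j c = 1 + vecMulVec (Pi.single i 1) (Pi.single j c) := by
  rw [transvection]
  congr 1
  ext a b
  simp only [single_apply, vecMulVec_apply, Pi.single_apply]
  rcases eq_or_ne a i with rfl | h1 <;> rcases eq_or_ne b j with rfl | h2 <;>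
    simp [*, Ne.symm]

theorem transvGL_eq (i j : ι) (hij : i ≠ j) (c : F) :
    transvGL i j hij c = rankOneGL (Pi.single i 1) (Pi.single j c) (by simp [hij.symm]) :=
  Units.ext (transvection_eq i j c)

theorem rankOneGL_conj (g : GL ι F) (w φ : ι → F) (h : φ ⬝ᵥ w = 0) :
    g * rankOneGL w φ h * g⁻¹ =
      rankOneGL (g.1 *ᵥ w) (φ ᵥ* (g⁻¹).1) (by
        rw [dotProduct_mulVec, vecMul_vecMul, Units.inv_mul, vecMul_one, h]) := by
  apply Units.ext
  change g.1 * (1 + vecMulVec w φ) * (g⁻¹).1 = 1 + vecMulVec _ _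
  rw [mul_add, add_mul, mul_one, Units.mul_inv, ← mul_vecMulVec, ← vecMulVec_mul, ← mul_assoc]

/-- Write the factors as `1 + A` and `1 + B`. Since `A² = B² = BA = 0`, only `1 + AB` survives. This
lets the functional of a transvection be replaced by a multiple of `e` while its vector `w` is kept.
-/
theorem rankOneGL_commutator (w φ a e : ι → F) (h : φ ⬝ᵥ w = 0) (h' : e ⬝ᵥ a = 0)
    (hew : e ⬝ᵥ w = 0) :
    rankOneGL w φ h * rankOneGL a e h' * (rankOneGL w φ h)⁻¹ * (rankOneGL a e h')⁻¹ =
      rankOneGL w ((φ ⬝ᵥ a) • e) (by simp [hew]) := by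
  apply Units.ext
  change (1 + vecMulVec w φ) * (1 + vecMulVec a e) * (1 - vecMulVec w φ) * (1 - vecMulVec a e) =
    1 + vecMulVec w _
  have h1 : vecMulVec w φ * vecMulVec w φ = 0 := by simp [vecMulVec_mul_vecMulVec, h]
  have h2 : vecMulVec a e * vecMulVec a e = 0 := by simp [vecMulVec_mul_vecMulVec, h']
  have h3 : vecMulVec a e * vecMulVec w φ = 0 := by simp [vecMulVec_mul_vecMulVec, hew]
  have h4 : vecMulVec w φ * vecMulVec a e = vecMulVec w ((φ ⬝ᵥ a) • e) := by
    simp [vecMulVec_mul_vecMulVec]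
  rw [← h4]
  generalize vecMulVec w φ = A at *
  generalize vecMulVec a e = B at *
  have : (1 + A) * (1 + B) * (1 - A) * (1 - B) = 1 + A * B - B * A + A * B * A * B + B * A * B
      - A * A - B * B + A * A * B - A * B * A - A * B * B := by
    noncomm_ring
  rw [this, mul_assoc A B A, mul_assoc A B B, h1, h2, h3]
  simp

theorem exists_GL_mulVec_single (w : ι → F) (k : ι) (hk : w k ≠ 0) :
    ∃ g : GL ι F, g.1 *ᵥ Pi.single k 1 = w := by
  have hd : (updateCol (1 : Matrix ι ι F) k w).det = w k := by
    rw [← cramer_apply, cramer_one]; rfl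
  refine ⟨GeneralLinearGroup.mkOfDetNeZero (updateCol (1 : Matrix ι ι F) k w) (by rwa [hd]), ?_⟩
  ext i
  change (updateCol (1 : Matrix ι ι F) k w *ᵥ Pi.single k 1) i = w i
  simp

theorem exists_GL_mulVec_eq_single (w : ι → F) (hw : w ≠ 0) (i : ι) :
    ∃ g : GL ι F, g.1 *ᵥ w = Pi.single i 1 := by
  obtain ⟨k, hk⟩ := Function.ne_iff.1 hw
  obtain ⟨g, hg⟩ := exists_GL_mulVec_single w k hk
  have key : ∃ g' : GL ι F, g'.1 *ᵥ Pi.single k 1 = Pi.single i 1 := by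
    by_cases hik : i = k
    · exact ⟨1, by rw [hik, Units.val_one, one_mulVec]⟩
    -- Pass through the sum of the two basis vectors, whose coordinates at `k` and at `i` are both
    -- nonzero.
    · obtain ⟨g₁, h₁⟩ := exists_GL_mulVec_single (Pi.single k 1 + Pi.single i 1 : ι → F) k
        (by simp [Ne.symm hik])
      obtain ⟨g₂, h₂⟩ := exists_GL_mulVec_single (Pi.single k 1 + Pi.single i 1 : ι → F) i
        (by simp [hik])
      refine ⟨g₂⁻¹ * g₁, ?_⟩
      rw [Units.val_mul, ← mulVec_mulVec, h₁, ← h₂, mulVec_mulVec, Units.inv_mul, one_mulVec]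
  obtain ⟨g', hg'⟩ := key
  refine ⟨g' * g⁻¹, ?_⟩
  rw [Units.val_mul, ← mulVec_mulVec, ← hg, mulVec_mulVec (M := (g⁻¹).1), Units.inv_mul, one_mulVec,
    hg']

variable {K : Subgroup (GL ι F)}

theorem commutator_mem_of_mem [K.Normal] {g : GL ι F} (hg : g ∈ K) (h : GL ι F) :
    g * h * g⁻¹ * h⁻¹ ∈ K := by
  rw [mul_assoc, mul_assoc]
  refine K.mul_mem hg ?_
  rw [← mul_assoc]
  exact Subgroup.Normal.conj_mem inferInstance _ (K.inv_mem hg) h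

/-- The commutator with the transvection of vector `(c / φ k) • e_k` and functional `e_j` has
functional `c • e_j`. -/
theorem transvGL_mem_of_apply_ne_zero [K.Normal] {i j k : ι} (hij : i ≠ j) (hkj : k ≠ j)
    {φ : ι → F} (h : φ ⬝ᵥ Pi.single i 1 = 0) (hk : φ k ≠ 0)
    (hK : rankOneGL (Pi.single i 1) φ h ∈ K) (c : F) : transvGL i j hij c ∈ K := by
  have := commutator_mem_of_mem hK (rankOneGL (Pi.single k (c / φ k)) (Pi.single j 1)
    (by simp [hkj.symm]))
  rw [rankOneGL_commutator _ _ _ _ _ _ (by simp [hij.symm])] at this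
  rw [transvGL_eq]
  convert this using 2
  ext x
  by_cases hx : x = j
  · subst hx; simp; field_simp
  · simp [hx]

theorem transvGL_mem_of_rankOneGL_mem [K.Normal] (hι : 3 ≤ Fintype.card ι) {w φ : ι → F}
    (h : φ ⬝ᵥ w = 0) (hw : w ≠ 0) (hφ : φ ≠ 0) (hK : rankOneGL w φ h ∈ K) (i j : ι) (hij : i ≠ j)
    (c : F) : transvGL i j hij c ∈ K := by
  obtain ⟨g, hg⟩ := exists_GL_mulVec_eq_single w hw i
  have h1 := Subgroup.Normal.conj_mem ‹K.Normal› _ hK g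
  rw [rankOneGL_conj] at h1
  have h2 : φ ᵥ* (g⁻¹).1 ≠ 0 := by
    intro h0
    apply hφ
    have := congrArg (· ᵥ* g.1) h0
    simpa [vecMul_vecMul] using this
  obtain ⟨ψ, hψ⟩ : ∃ ψ, ψ = φ ᵥ* (g⁻¹).1 := ⟨_, rfl⟩
  have h4 : ψ ⬝ᵥ Pi.single i 1 = 0 := by
    rw [hψ, ← hg, dotProduct_mulVec, vecMul_vecMul, Units.inv_mul, vecMul_one, h]
  have h3 : rankOneGL (Pi.single i 1) ψ h4 ∈ K := by
    convert h1 using 2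
    exact hg.symm
  obtain ⟨k, hk⟩ := Function.ne_iff.1 (hψ ▸ h2 : ψ ≠ 0)
  by_cases hkj : k = j
  -- If the nonzero coordinate is at `j` itself, detour through a third index `l`: first obtain a
  -- transvection with functional `e_l`, then move from `l` to `j`.
  · obtain ⟨l, hl⟩ : ∃ l, l ∉ ({i, j} : Finset ι) := by
      by_contra! hcon
      have := Finset.card_le_card (fun x _ => hcon x : Finset.univ ⊆ ({i, j} : Finset ι))
      have h2 := Finset.card_le_two (a := i) (b := j)
      rw [Finset.card_univ] at this
      omega
    simp only [Finset.mem_insert, Finset.mem_singleton, not_or] at hl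
    have h5 := transvGL_mem_of_apply_ne_zero (j := l) (Ne.symm hl.1) (hkj ▸ Ne.symm hl.2) h4 hk h3 1
    rw [transvGL_eq] at h5
    exact transvGL_mem_of_apply_ne_zero (k := l) hij hl.2 _ (by simp) h5 c
  · exact transvGL_mem_of_apply_ne_zero hij hkj h4 hk h3 c

/-- A nontrivial element of a normal subgroup that fixes a nonzero vector yields a transvection. -/
theorem transvGL_mem_of_fixed [K.Normal] (hι : 3 ≤ Fintype.card ι) {h : GL ι F} (hK : h ∈ K)
    (h1 : h ≠ 1) {w : ι → F} (hw : w ≠ 0) (hfix : h.1 *ᵥ w = w) (i j : ι) (hij : i ≠ j) (c : F) :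
    transvGL i j hij c ∈ K := by
  -- If `h` moves a functional `e` vanishing at `w`, the commutator of `h` with `1 + w e` is `1 + w
  -- (e h⁻¹ - e)`. Otherwise `h` fixes every such functional, and `h` itself turns out to be a
  -- transvection along `w`.
  by_cases he : ∃ e : ι → F, e ⬝ᵥ w = 0 ∧ e ᵥ* (h⁻¹).1 ≠ e
  · obtain ⟨e, hew, hne⟩ := he
    have h2 := commutator_mem_of_mem hK (rankOneGL w e hew)
    rw [rankOneGL_conj] at h2
    have h3 : (e ᵥ* (h⁻¹).1 - e) ⬝ᵥ w = 0 := by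
      rw [sub_dotProduct, hew, sub_zero]
      conv_lhs => rw [← hfix]
      rw [dotProduct_mulVec, vecMul_vecMul, Units.inv_mul, vecMul_one, hew]
    refine transvGL_mem_of_rankOneGL_mem hι h3 hw (sub_ne_zero.2 hne) ?_ i j hij c
    convert h2 using 1
    apply Units.ext
    change 1 + vecMulVec w _ = (1 + vecMulVec (h.1 *ᵥ w) _) * (1 - vecMulVec w e)
    rw [hfix, add_mul, mul_sub, mul_sub, vecMulVec_mul_vecMulVec]
    have h4 : e ᵥ* (h⁻¹).1 ⬝ᵥ w = 0 := by rwa [sub_dotProduct, hew, sub_zero] at h3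
    rw [h4]
    ext a b
    simp [vecMulVec_apply]
    ring
  · push Not at he
    obtain ⟨k, hk⟩ := Function.ne_iff.1 hw
    have hk : w k ≠ 0 := hk
    let φ : ι → F := fun b => (w k)⁻¹ * (h.1 - 1) k b
    have hh : ∀ e : ι → F, e ⬝ᵥ w = 0 → e ᵥ* h.1 = e := by
      intro e hew
      have := congrArg (· ᵥ* h.1) (he e hew)
      simpa [vecMul_vecMul, eq_comm] using this
    have hv : h.1 = 1 + vecMulVec w φ := by
      ext a b
      -- This functional vanishes at `w`, so row `a` of `h - 1` is `w a / w k` times row `k`.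
      have := congrFun (hh (Pi.single a (w k) - Pi.single k (w a)) (by simp [mul_comm])) b
      simp only [sub_vecMul, Pi.sub_apply, single_vecMul] at this
      simp only [Matrix.add_apply, vecMulVec_apply, φ, Matrix.sub_apply]
      have e1 : ∀ x y, (Pi.single x y : ι → F) b = y * (1 : Matrix ι ι F) x b := by
        intro x y
        by_cases hxb : x = b
        · subst hxb; simp
        · simp [hxb, Ne.symm hxb]
      rw [e1, e1] at this
      simp only [row_apply, Pi.smul_apply, smul_eq_mul] at this
      field_simp
      linear_combination this
    have hφw : φ ⬝ᵥ w = 0 := by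
      have h5 := congrFun hfix k
      rw [hv, add_mulVec, one_mulVec, vecMulVec_mulVec] at h5
      simpa [hk] using h5
    have hφ : φ ≠ 0 := by
      rintro h0
      apply h1
      apply Units.ext
      rw [hv, h0]
      simp
    refine transvGL_mem_of_rankOneGL_mem hι hφw hw hφ ?_ i j hij c
    convert hK using 1
    exact Units.ext hv.symm

theorem exists_ne_zero_dotProduct_eq_zero (hι : 3 ≤ Fintype.card ι) (f f' : ι → F) :
    ∃ w : ι → F, w ≠ 0 ∧ f ⬝ᵥ w = 0 ∧ f' ⬝ᵥ w = 0 := by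
  let T : (ι → F) →ₗ[F] (Fin 2 → F) := (Matrix.of ![f, f']).mulVecLin
  have hT := LinearMap.ker_ne_bot_of_finrank_lt (f := T) (by simp; omega)
  obtain ⟨w, hw, hw0⟩ := (Submodule.ne_bot_iff _).1 hT
  refine ⟨w, hw0, ?_, ?_⟩
  · exact congrFun (LinearMap.mem_ker.1 hw) 0
  · exact congrFun (LinearMap.mem_ker.1 hw) 1

/-- A normal subgroup of `GL` in dimension at least three that is not central contains all
transvections. -/
theorem transvGL_mem_of_not_le_center [K.Normal] (hι : 3 ≤ Fintype.card ι)
    (hK : ¬ K ≤ Subgroup.center (GL ι F)) (i j : ι) (hij : i ≠ j) (c : F) :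
    transvGL i j hij c ∈ K := by
  obtain ⟨g, hgK, hg⟩ := SetLike.not_le_iff_exists.1 hK
  rw [GeneralLinearGroup.mem_center_iff_val_mem_range_scalar] at hg
  have : ∃ t : TransvectionStruct ι F, ¬ Commute t.toMatrix g.1 := by
    by_contra! hcon
    exact hg (mem_range_scalar_of_commute_transvectionStruct hcon)
  obtain ⟨⟨a, b, hab, d⟩, ht⟩ := this
  let t := transvGL a b hab d
  have hmem := commutator_mem_of_mem hgK t
  -- The commutator of `g` and `t` is a product of two transvections. In dimension at least three
  -- their functionals have a common nonzero zero, which the commutator fixes.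
  obtain ⟨w, hw, h1, h2⟩ := exists_ne_zero_dotProduct_eq_zero hι (Pi.single b d)
    (Pi.single b d ᵥ* (g⁻¹).1)
  refine transvGL_mem_of_fixed hι hmem ?_ hw ?_ i j hij c
  · intro h0
    rw [mul_inv_eq_one, mul_inv_eq_iff_eq_mul] at h0
    exact ht (congrArg Units.val h0).symm
  · have e1 : t⁻¹.1 *ᵥ w = w := by
      change transvection a b (-d) *ᵥ w = w
      rw [transvection_eq, add_mulVec, vecMulVec_mulVec]
      have : (Pi.single b (-d)) ⬝ᵥ w = 0 := by simpa using h1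
      rw [this]
      simp
    have e2 : (g * t * g⁻¹).1 *ᵥ w = w := by
      have : t = rankOneGL _ _ _ := transvGL_eq a b hab d
      rw [this, rankOneGL_conj]
      change (1 + vecMulVec _ _) *ᵥ w = w
      rw [add_mulVec, vecMulVec_mulVec, h2]
      simp
    rw [Units.val_mul, ← mulVec_mulVec, e1, e2]

/-- Gaussian elimination factors `g` as transvections, a diagonal matrix, transvections; normality
moves the left factor past the diagonal one. So `GL / K` is a quotient of the diagonal torus, which
makes it abelian and bounds its order. -/
theorem exists_diagonal_mul_mem [K.Normal]
    (hK : ∀ (i j : ι) (hij : i ≠ j) (c : F), transvGL i j hij c ∈ K) (g : GL ι F) :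
    ∃ d : ι → Fˣ, ∃ k ∈ K, g = GeneralLinearGroup.mkOfDetNeZero (diagonal fun i => (d i : F))
      (by simp [Finset.prod_ne_zero_iff]) * k := by
  have hlist : ∀ L : List (TransvectionStruct ι F),
      ∃ k ∈ K, k.1 = (L.map TransvectionStruct.toMatrix).prod := by
    intro L
    induction L with
    | nil => exact ⟨1, K.one_mem, by simp⟩
    | cons t L ih =>
      obtain ⟨k, hk, e⟩ := ih
      exact ⟨transvGL t.i t.j t.hij t.c * k, K.mul_mem (hK _ _ _ _) hk, by
        simp only [List.map_cons, List.prod_cons, Units.val_mul, e]; rfl⟩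
  obtain ⟨L, L', D, hD⟩ := Pivot.exists_list_transvec_mul_diagonal_mul_list_transvec g.1
  obtain ⟨k, hk, ek⟩ := hlist L
  obtain ⟨k', hk', ek'⟩ := hlist L'
  have hdet : (diagonal D).det ≠ 0 := by
    intro h0
    have h1 : g.1.det ≠ 0 := ((Matrix.isUnit_iff_isUnit_det _).1 g.isUnit).ne_zero
    apply h1
    rw [hD, det_mul, det_mul, h0]
    simp
  have hDi : ∀ i, D i ≠ 0 := by
    rw [det_diagonal, Finset.prod_ne_zero_iff] at hdet
    exact fun i => hdet i (Finset.mem_univ _)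
  let δ := GeneralLinearGroup.mkOfDetNeZero (diagonal D) hdet
  refine ⟨fun i => Units.mk0 (D i) (hDi i), δ⁻¹ * k * δ * k', ?_, ?_⟩
  · refine K.mul_mem ?_ hk'
    have := Subgroup.Normal.conj_mem ‹K.Normal› _ hk δ⁻¹
    rwa [inv_inv] at this
  · have e : g = k * δ * k' := by
      apply Units.ext
      rw [hD, ← ek, ← ek']
      rfl
    rw [e]
    change _ = δ * _
    group

theorem commutator_mem_of_transvGL_mem [K.Normal]
    (hK : ∀ (i j : ι) (hij : i ≠ j) (c : F), transvGL i j hij c ∈ K) (g h : GL ι F) :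
    g * h * g⁻¹ * h⁻¹ ∈ K := by
  obtain ⟨d, k, hk, hg⟩ := exists_diagonal_mul_mem hK g
  obtain ⟨d', k', hk', hh⟩ := exists_diagonal_mul_mem hK h
  have e : ∀ x ∈ K, (QuotientGroup.mk' K) x = 1 := fun x hx => (QuotientGroup.eq_one_iff x).2 hx
  rw [← QuotientGroup.ker_mk' K, MonoidHom.mem_ker, map_mul, map_inv, mul_inv_eq_one, map_mul,
    map_inv, mul_inv_eq_iff_eq_mul, hg, hh]
  simp only [map_mul, e k hk, e k' hk', mul_one]
  rw [← map_mul, ← map_mul]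
  congr 1
  apply Units.ext
  change diagonal _ * diagonal _ = diagonal _ * diagonal _
  simp [mul_comm]

theorem card_GL_le_of_transvGL_mem [Finite F] [K.Normal]
    (hK : ∀ (i j : ι) (hij : i ≠ j) (c : F), transvGL i j hij c ∈ K) :
    Nat.card (GL ι F) ≤ (Nat.card F - 1) ^ Fintype.card ι * Nat.card K := by
  have : Nat.card (ι → Fˣ) = (Nat.card F - 1) ^ Fintype.card ι := by
    rw [Nat.card_pi, Finset.prod_const, Finset.card_univ, Nat.card_units]
  rw [← this, ← Nat.card_prod]
  refine Nat.card_le_card_of_surjective (fun x : (ι → Fˣ) × K =>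
    GeneralLinearGroup.mkOfDetNeZero (diagonal fun i => (x.1 i : F))
      (by simp [Finset.prod_ne_zero_iff]) * x.2.1) fun g => ?_
  obtain ⟨d, k, hk, hg⟩ := exists_diagonal_mul_mem hK g
  exact ⟨(d, ⟨k, hk⟩), hg.symm⟩

end NormalSubgroups

end InfMatrix

namespace InfMatrix

open Matrix

/-! ### Orders of linear groups over a finite field -/

section Cardinalities

variable {F : Type*} [Field F] [Finite F]

theorem card_GL_succ (n : ℕ) : Nat.card (GL (Fin (n + 1)) F) =
    Nat.card F ^ n * (Nat.card F ^ (n + 1) - 1) * Nat.card (GL (Fin n) F) := by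
  have := Fintype.ofFinite F
  rw [card_GL_field, card_GL_field, Fin.prod_univ_succ, Nat.card_eq_fintype_card]
  have : ∀ i : Fin n, Fintype.card F ^ (n + 1) - Fintype.card F ^ ((i.succ : Fin (n + 1)) : ℕ) =
      Fintype.card F * (Fintype.card F ^ n - Fintype.card F ^ (i : ℕ)) := by
    intro i
    rw [Nat.mul_sub, Fin.val_succ, pow_succ', pow_succ']
  simp only [this, Finset.prod_mul_distrib, Finset.prod_const, Finset.card_univ, Fintype.card_fin]
  simp
  ring

theorem card_GL_congr {ι : Type*} [Fintype ι] [DecidableEq ι] :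
    Nat.card (GL ι F) = Nat.card (GL (Fin (Fintype.card ι)) F) :=
  Nat.card_congr (Units.mapEquiv
    (reindexAlgEquiv F F (Fintype.equivFin ι)).toRingEquiv.toMulEquiv).toEquiv

theorem one_le_card_factor (n : ℕ) : 1 ≤ Nat.card F ^ n * (Nat.card F ^ (n + 1) - 1) := by
  have hq : 1 < Nat.card F := Finite.one_lt_card
  have : 1 < Nat.card F ^ (n + 1) := Nat.one_lt_pow (by omega) hq
  exact Nat.mul_pos (by positivity) (by omega)

theorem card_GL_mono {m n : ℕ} (h : m ≤ n) :
    Nat.card (GL (Fin m) F) ≤ Nat.card (GL (Fin n) F) := by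
  induction n, h using Nat.le_induction with
  | base => exact le_rfl
  | succ k _ ih =>
    rw [card_GL_succ]
    exact ih.trans (Nat.le_mul_of_pos_left _ (one_le_card_factor k))

/-- The exponent `n + 1` allows for the diagonal torus and the centre. With `n = k + 1`, the ratio
of the orders of `GL_{k+1}` and `GL_k` is `q^k (q^(k+1) - 1)`, which exceeds `(q - 1)^(k+2)` because
`k ≥ 1`. -/
theorem card_GL_mul_pow_lt {m n : ℕ} (hmn : m < n) (hn : 2 ≤ n) :
    Nat.card (GL (Fin m) F) * (Nat.card F - 1) ^ (n + 1) < Nat.card (GL (Fin n) F) := by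
  obtain ⟨k, rfl⟩ : ∃ k, n = k + 1 := ⟨n - 1, by omega⟩
  have hq : 1 < Nat.card F := Finite.one_lt_card
  obtain ⟨r, hr⟩ : ∃ r, Nat.card F = r + 1 := ⟨Nat.card F - 1, by omega⟩
  have hpos : 0 < Nat.card (GL (Fin k) F) := Nat.card_pos
  rw [card_GL_succ]
  calc _ ≤ Nat.card (GL (Fin k) F) * (Nat.card F - 1) ^ (k + 1 + 1) :=
        Nat.mul_le_mul_right _ (card_GL_mono (by omega))
    _ < Nat.card (GL (Fin k) F) * (Nat.card F ^ k * (Nat.card F ^ (k + 1) - 1)) := by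
        refine (Nat.mul_lt_mul_left hpos).2 ?_
        rw [hr, Nat.add_sub_cancel]
        have h1 : r * (r + 1) ^ k ≤ (r + 1) ^ (k + 1) - 1 := by
          have : 1 ≤ (r + 1) ^ k := Nat.one_le_pow _ _ (by omega)
          have e : (r + 1) ^ (k + 1) = r * (r + 1) ^ k + (r + 1) ^ k := by ring
          omega
        have h2 : r ^ (k + 1) < (r + 1) ^ k * (r + 1) ^ k := by
          calc r ^ (k + 1) < (r + 1) ^ (k + 1) := Nat.pow_lt_pow_left (by omega) (by omega)
            _ ≤ (r + 1) ^ (k + k) := Nat.pow_le_pow_right (by omega) (by omega)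
            _ = _ := pow_add _ _ _
        calc r ^ (k + 1 + 1) = r * r ^ (k + 1) := by ring
          _ < r * ((r + 1) ^ k * (r + 1) ^ k) := (Nat.mul_lt_mul_left (by omega)).2 h2
          _ = (r + 1) ^ k * (r * (r + 1) ^ k) := by ring
          _ ≤ _ := Nat.mul_le_mul_left _ h1
    _ = _ := by ring

theorem card_center_GL_le {ι : Type*} [Fintype ι] [DecidableEq ι] :
    Nat.card (Subgroup.center (GL ι F)) ≤ Nat.card F - 1 := by
  rw [GeneralLinearGroup.center_eq_range_scalar, ← Nat.card_units]
  exact Nat.card_le_card_of_surjective _ (GeneralLinearGroup.scalar ι).rangeRestrict_surjective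

theorem card_le_card_map_mul_card_ker {G H : Type*} [Group G] [Group H] [Finite G] (f : G →* H)
    (A : Subgroup G) : Nat.card A ≤ Nat.card (A.map f) * Nat.card f.ker := by
  have h := Subgroup.card_mul_index (f.comp A.subtype).ker
  rw [Subgroup.index_ker, MonoidHom.range_comp, Subgroup.range_subtype, mul_comm] at h
  rw [← h]
  refine Nat.mul_le_mul_left _ (Nat.card_le_card_of_injective
    (fun x : (f.comp A.subtype).ker => (⟨x.1.1, x.2⟩ : f.ker)) ?_)
  intro x y hxy
  exact Subtype.ext (Subtype.ext (congrArg (fun z : f.ker => z.1) hxy))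

instance {ι : Type*} [Fintype ι] [DecidableEq ι] : Finite (ProjGenLinGroup ι F) :=
  Finite.of_surjective _ ProjGenLinGroup.mk_surjective

theorem card_GL_le_card_PGL {ι : Type*} [Fintype ι] [DecidableEq ι] :
    Nat.card (GL ι F) ≤ Nat.card (ProjGenLinGroup ι F) * (Nat.card F - 1) := by
  have h := card_le_card_map_mul_card_ker (ProjGenLinGroup.mk (n := ι) (R := F)) ⊤
  rw [ProjGenLinGroup.ker_mk, Subgroup.card_top] at h
  exact h.trans (Nat.mul_le_mul (Subgroup.card_le_card_group _) card_center_GL_le)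

/-- A crude bound: all that matters is that the order of `PGL_n` is unbounded in `n`. -/
theorem le_card_PGL (n : ℕ) : n ≤ Nat.card (ProjGenLinGroup (Fin n) F) := by
  rcases n with _ | k
  · exact Nat.zero_le _
  have hq : 1 < Nat.card F := Finite.one_lt_card
  have h := card_GL_le_card_PGL (F := F) (ι := Fin (k + 1))
  rw [card_GL_succ] at h
  have hpos : 0 < Nat.card (GL (Fin k) F) := Nat.card_pos
  have h1 : Nat.card F - 1 ≤ Nat.card F ^ (k + 1) - 1 :=
    Nat.sub_le_sub_right (Nat.le_self_pow (by omega) _) 1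
  have h2 : Nat.card F ^ k * (Nat.card F - 1) ≤
      Nat.card (ProjGenLinGroup (Fin (k + 1)) F) * (Nat.card F - 1) :=
    (Nat.mul_le_mul_left _ h1).trans ((Nat.le_mul_of_pos_right _ hpos).trans h)
  exact (Nat.lt_pow_self hq).trans_le (Nat.le_of_mul_le_mul_right h2 (by omega))

end Cardinalities

/-! ### Normal subgroups and `p`-torsion in `PGL_n` -/

section ProjectiveGroup

variable {F : Type*} [Field F] {n : ℕ}

theorem comap_mk_not_le_center {H : Subgroup (ProjGenLinGroup (Fin n) F)} (hH : H ≠ ⊥) :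
    ¬ H.comap ProjGenLinGroup.mk ≤ Subgroup.center (GL (Fin n) F) := by
  intro h
  refine hH ((Subgroup.eq_bot_iff_forall _).2 fun x hx => ?_)
  obtain ⟨g, rfl⟩ := ProjGenLinGroup.mk_surjective x
  exact ProjGenLinGroup.mk_eq_one.2 (h hx)

theorem mk_transvGL_mem {H : Subgroup (ProjGenLinGroup (Fin n) F)} [H.Normal] (hn : 3 ≤ n)
    (hH : H ≠ ⊥) (i j : Fin n) (hij : i ≠ j) (c : F) :
    ProjGenLinGroup.mk (transvGL i j hij c) ∈ H :=
  transvGL_mem_of_not_le_center (K := H.comap ProjGenLinGroup.mk) (by simpa using hn)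
    (comap_mk_not_le_center hH) i j hij c

theorem card_GL_le_card_normal [Finite F] {H : Subgroup (ProjGenLinGroup (Fin n) F)} [H.Normal]
    (hn : 3 ≤ n) (hH : H ≠ ⊥) :
    Nat.card (GL (Fin n) F) ≤ Nat.card H * (Nat.card F - 1) ^ (n + 1) := by
  have h1 := card_GL_le_of_transvGL_mem (K := H.comap ProjGenLinGroup.mk)
    (transvGL_mem_of_not_le_center (by simpa using hn) (comap_mk_not_le_center hH))
  have h2 := card_le_card_map_mul_card_ker ProjGenLinGroup.mk (H.comap ProjGenLinGroup.mk)
  rw [Subgroup.map_comap_eq_self_of_surjective ProjGenLinGroup.mk_surjective,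
    ProjGenLinGroup.ker_mk] at h2
  rw [Fintype.card_fin] at h1
  calc _ ≤ _ := h1
    _ ≤ (Nat.card F - 1) ^ n * (Nat.card H * (Nat.card F - 1)) :=
        Nat.mul_le_mul_left _ (h2.trans (Nat.mul_le_mul_left _ card_center_GL_le))
    _ = _ := by ring

theorem exists_val_eq_scalar_of_mk_eq_one {g : GL (Fin n) F} (h : ProjGenLinGroup.mk g = 1) :
    ∃ c : F, g.1 = scalar (Fin n) c := by
  obtain ⟨c, hc⟩ := GeneralLinearGroup.mem_center_iff_val_mem_range_scalar.1
    (ProjGenLinGroup.mk_eq_one.1 h)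
  exact ⟨c, hc.symm⟩

/-- A nontrivial `H` contains the image of a product `g = 1 + x` of two transvections, where `x` has
block `(1 1; 1 0)` on the first two coordinates and is zero elsewhere. If `g^(p^k)` is scalar, it is
`1`, as `g` fixes the third basis vector, so `x` is nilpotent. But `x (x² - x - 1) = 0`, and then
the second factor is a unit, forcing `x = 0`. -/
theorem eq_bot_of_normal_of_torsion (p : ℕ) [Fact p.Prime] [CharP F p]
    {H : Subgroup (ProjGenLinGroup (Fin n) F)} [H.Normal] (hn : 3 ≤ n)
    (htor : ∀ x ∈ H, ∃ k : ℕ, x ^ p ^ k = 1) : H = ⊥ := by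
  by_contra hH
  obtain ⟨m, rfl⟩ : ∃ m, n = m + 3 := ⟨n - 3, by omega⟩
  have h01 : (0 : Fin (m + 3)) ≠ 1 := by simp
  let g := transvGL (0 : Fin (m + 3)) 1 h01 (1 : F) * transvGL 1 0 h01.symm 1
  have hg : ProjGenLinGroup.mk g ∈ H := by
    rw [map_mul]
    exact H.mul_mem (mk_transvGL_mem hn hH _ _ _ _) (mk_transvGL_mem hn hH _ _ _ _)
  obtain ⟨k, hk⟩ := htor _ hg
  rw [← map_pow] at hk
  obtain ⟨c, hc⟩ := exists_val_eq_scalar_of_mk_eq_one hk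
  rw [Units.val_pow_eq_pow_val] at hc
  obtain ⟨x, hx⟩ : ∃ x : Matrix (Fin (m + 3)) (Fin (m + 3)) F,
    x = single 0 0 1 + single 0 1 1 + single 1 0 1 := ⟨_, rfl⟩
  have hgx : g.1 = 1 + x := by
    change transvection 0 1 1 * transvection 1 0 1 = _
    simp only [transvection, add_mul, mul_add, one_mul, mul_one, single_mul_single_same, hx]
    abel
  have h20 : (2 : Fin (m + 3)) ≠ 0 := by
    simp [Fin.ext_iff, Nat.mod_eq_of_lt (show 2 < m + 3 by omega)]
  have h21 : (2 : Fin (m + 3)) ≠ 1 := by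
    simp [Fin.ext_iff, Nat.mod_eq_of_lt (show 2 < m + 3 by omega)]
  have hfix : ∀ N : ℕ, g.1 ^ N *ᵥ Pi.single 2 1 = Pi.single 2 1 := by
    have h1 : g.1 *ᵥ Pi.single 2 1 = Pi.single 2 1 := by
      rw [hgx, add_mulVec, one_mulVec, add_eq_left]
      ext i
      simp [hx, h20.symm, h21.symm]
    intro N
    induction N with
    | zero => rw [pow_zero, one_mulVec]
    | succ N ih => rw [pow_succ, ← mulVec_mulVec, h1, ih]
  have hc1 : c = 1 := by
    have := congrFun (hfix (p ^ k)) 2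
    rw [hc] at this
    simpa using this
  rw [hc1, map_one, hgx, add_pow_char_pow_of_commute p k (Commute.one_left x), one_pow,
    add_eq_left] at hc
  have hnil : IsNilpotent x := ⟨_, hc⟩
  have hcub : x * (x * x - x - 1) = 0 := by
    have e : x * x = x + (single 0 0 1 + single 1 1 1) := by
      simp only [hx, add_mul, mul_add, single_mul_single_same, mul_one,
        single_mul_single_of_ne _ _ _ _ h01, single_mul_single_of_ne _ _ _ _ h01.symm]
      abel
    rw [e, hx]
    simp only [add_mul, mul_add, mul_sub, single_mul_single_same, mul_one,
        single_mul_single_of_ne _ _ _ _ h01, single_mul_single_of_ne _ _ _ _ h01.symm]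
    abel
  have hun : IsUnit (x * x - x - 1) := by
    refine IsNilpotent.isUnit_sub_one ?_
    have : x * x - x = x * (x - 1) := by rw [mul_sub, mul_one]
    rw [this]
    exact Commute.isNilpotent_mul_right ((Commute.refl x).sub_right (Commute.one_right x)) hnil
  have hx0 : x = 0 := hun.mul_left_eq_zero.1 hcub
  have := congrFun (congrFun hx0 0) 0
  rw [hx] at this
  simp [h01.symm] at this

theorem not_commute_mk_transvGL (hn : 3 ≤ n) : ∃ (i j : Fin n) (hij : i ≠ j),
    ¬ Commute (ProjGenLinGroup.mk (transvGL i j hij (1 : F)))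
      (ProjGenLinGroup.mk (transvGL j i hij.symm 1)) := by
  obtain ⟨m, rfl⟩ : ∃ m, n = m + 3 := ⟨n - 3, by omega⟩
  have h01 : (0 : Fin (m + 3)) ≠ 1 := by simp
  have h20 : (2 : Fin (m + 3)) ≠ 0 := by
    simp [Fin.ext_iff, Nat.mod_eq_of_lt (show 2 < m + 3 by omega)]
  have h21 : (2 : Fin (m + 3)) ≠ 1 := by
    simp [Fin.ext_iff, Nat.mod_eq_of_lt (show 2 < m + 3 by omega)]
  refine ⟨0, 1, h01, fun h => ?_⟩
  have h := h.eq
  rw [← map_mul, ← map_mul, ProjGenLinGroup.mk_eq_mk_iff] at h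
  obtain ⟨u, hu⟩ := h
  have hu := congrArg Units.val hu
  change transvection 0 1 1 * transvection 1 0 1 * scalar (Fin (m + 3)) (u : F) =
    transvection 1 0 1 * transvection 0 1 1 at hu
  simp only [transvection, add_mul, mul_add, one_mul, mul_one, single_mul_single_same] at hu
  -- Entry `(2, 2)` forces the scalar to be `1`; entry `(0, 0)` then reads `2 = 1`.
  have e2 := congrFun (congrFun hu 2) 2
  have e0 := congrFun (congrFun hu 0) 0
  simp [h20.symm, h21.symm, h01.symm] at e2 e0
  simp [e2] at e0

/-- The derived subgroup of `PGL_2` over a finite field is not a `p`-group. -/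
theorem exists_commutator_not_torsion [Finite F] (p : ℕ) [Fact p.Prime] [CharP F p] :
    ∃ x y : ProjGenLinGroup (Fin 2) F, ∀ k : ℕ, (x * y * x⁻¹ * y⁻¹) ^ p ^ k ≠ 1 := by
  -- The commutator `M` below has determinant `1` and trace `2 + s²`. If a `p`-power of it were
  -- scalar, its characteristic polynomial would have a root `d` with `d² = 1`, giving `(2 + s²)² =
  -- 4`, that is `s² (s² + 4) = 0`. The choice `s = 1` avoids this except in characteristic five,
  -- where `s = 2` does.
  obtain ⟨s, hs0, hs⟩ : ∃ s : F, s ≠ 0 ∧ s ^ 2 + 4 ≠ 0 := by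
    by_cases h5 : (5 : F) = 0
    · have h2 : (2 : F) ≠ 0 := by
        intro h2
        exact one_ne_zero (α := F) (by linear_combination h5 - 2 * h2)
      refine ⟨2, h2, ?_⟩
      intro h
      exact pow_ne_zero 3 h2 (by linear_combination h)
    · exact ⟨1, one_ne_zero, fun h => h5 (by linear_combination h)⟩
  have h01 : (0 : Fin 2) ≠ 1 := by simp
  let a := transvGL (0 : Fin 2) 1 h01 s
  let b := transvGL (1 : Fin 2) 0 h01.symm (1 : F)
  refine ⟨ProjGenLinGroup.mk a, ProjGenLinGroup.mk b, fun k hk => ?_⟩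
  rw [← map_inv, ← map_inv, ← map_mul, ← map_mul, ← map_mul, ← map_pow] at hk
  obtain ⟨c, hc⟩ := exists_val_eq_scalar_of_mk_eq_one hk
  rw [Units.val_pow_eq_pow_val] at hc
  have hM : (a * b * a⁻¹ * b⁻¹).1 = !![1 + s + s ^ 2, -s ^ 2; s, 1 - s] := by
    change transvection 0 1 s * transvection 1 0 1 * transvection 0 1 (-s) * transvection 1 0 (-1)
      = _
    have e1 : ∀ t : F, transvection (0 : Fin 2) 1 t = !![1, t; 0, 1] := by
      intro t
      ext i j
      fin_cases i <;> fin_cases j <;> simp [transvection]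
    have e2 : ∀ t : F, transvection (1 : Fin 2) 0 t = !![1, 0; t, 1] := by
      intro t
      ext i j
      fin_cases i <;> fin_cases j <;> simp [transvection]
    rw [e1, e1, e2, e2]
    ext i j
    fin_cases i <;> fin_cases j <;> simp [Matrix.mul_apply, Fin.sum_univ_two] <;> ring
  rw [hM] at hc
  obtain ⟨M, hMM⟩ : ∃ M : Matrix (Fin 2) (Fin 2) F, M = !![1 + s + s ^ 2, -s ^ 2; s, 1 - s] :=
    ⟨_, rfl⟩
  rw [← hMM] at hc
  -- Frobenius is onto for finite `F`, so the scalar is a `p^k`-th power `d^(p^k)` and `M - d` is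
  -- nilpotent.
  obtain ⟨d, hd⟩ := (bijective_iterateFrobenius F p k).2 c
  rw [iterateFrobenius_def] at hd
  have hd2 : d ^ 2 = 1 := by
    have h1 := congrArg det hc
    rw [det_pow, hMM] at h1
    simp only [det_fin_two_of, scalar_apply, det_diagonal, Finset.prod_const, Finset.card_univ,
      Fintype.card_fin] at h1
    have h2 : (1 + s + s ^ 2) * (1 - s) - -s ^ 2 * s = 1 := by ring
    rw [h2, one_pow, ← hd, ← pow_mul, mul_comm, pow_mul] at h1
    apply (bijective_iterateFrobenius F p k).1
    rw [iterateFrobenius_def, ← h1, map_one]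
  have hnil : (M - scalar (Fin 2) d) ^ p ^ k = 0 := by
    rw [sub_pow_char_pow_of_commute p k (scalar_commute d (fun r' => Commute.all _ _) M).symm,
      hc, ← hd, ← map_pow, sub_self]
  have hdet : (M - scalar (Fin 2) d).det = 0 := by
    have h1 := congrArg det hnil
    rw [det_pow, det_zero] at h1
    exact pow_eq_zero_iff (pow_ne_zero _ (Fact.out : p.Prime).ne_zero) |>.1 h1
  have h3 : d * (2 + s ^ 2) = 2 := by
    rw [hMM, det_fin_two] at hdet
    simp at hdet
    linear_combination -hdet + hd2
  have h4 : s ^ 2 * (s ^ 2 + 4) = 0 := by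
    linear_combination (d * (2 + s ^ 2) + 2) * h3 - (2 + s ^ 2) ^ 2 * hd2
  rcases mul_eq_zero.1 h4 with h | h
  · exact hs0 (pow_eq_zero_iff (two_ne_zero) |>.1 h)
  · exact hs h

end ProjectiveGroup

end InfMatrix

namespace InfMatrix

open Matrix

/-! ### Homomorphisms from products of general linear groups to `PGL_n` -/

section LinearQuotients

variable {F : Type*} [Field F] [Finite F] {n : ℕ}

/-- A homomorphism from a larger general linear group to `PGL_n` has abelian image. -/
theorem commute_of_lt_card {ι : Type*} [Fintype ι] [DecidableEq ι] (hn : 2 ≤ n)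
    (hι : n < Fintype.card ι) (f : GL ι F →* ProjGenLinGroup (Fin n) F) (g h : GL ι F) :
    Commute (f g) (f h) := by
  -- A central kernel has order at most `q - 1`, and the image is no larger than `GL_n`: too little
  -- for the larger group. A noncentral kernel contains all transvections, hence all commutators.
  have hker : ¬ f.ker ≤ Subgroup.center (GL ι F) := by
    intro hle
    have h1 := card_le_card_map_mul_card_ker f ⊤
    rw [Subgroup.card_top, card_GL_congr] at h1
    have h2 : Nat.card f.ker ≤ Nat.card F - 1 :=
      (Subgroup.card_le_of_le hle).trans card_center_GL_le
    have h3 : Nat.card ((⊤ : Subgroup (GL ι F)).map f) ≤ Nat.card (GL (Fin n) F) :=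
      (Subgroup.card_le_card_group _).trans
        (Nat.card_le_card_of_surjective _ ProjGenLinGroup.mk_surjective)
    have h4 := card_GL_mul_pow_lt (F := F) hι (by omega)
    have hq : 1 < Nat.card F := Finite.one_lt_card
    have h5 : Nat.card F - 1 ≤ (Nat.card F - 1) ^ (Fintype.card ι + 1) :=
      Nat.le_self_pow (by omega) _
    have := h1.trans ((Nat.mul_le_mul h3 h2).trans (Nat.mul_le_mul_left _ h5))
    omega
  have := commutator_mem_of_transvGL_mem
    (transvGL_mem_of_not_le_center (by omega) hker) g h
  rwa [MonoidHom.mem_ker, map_mul, map_inv, mul_inv_eq_one, map_mul, map_inv,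
    mul_inv_eq_iff_eq_mul, map_mul] at this

/-- A homomorphism from a smaller general linear group to `PGL_n`, `n ≥ 3`, with normal image is
trivial. -/
theorem eq_one_of_card_lt {ι : Type*} [Fintype ι] [DecidableEq ι] (hn : 3 ≤ n)
    (hι : Fintype.card ι < n) (f : GL ι F →* ProjGenLinGroup (Fin n) F) (hf : f.range.Normal)
    (g : GL ι F) : f g = 1 := by
  by_contra hne
  have hbot : f.range ≠ ⊥ := fun h => hne ((Subgroup.eq_bot_iff_forall _).1 h _ ⟨g, rfl⟩)
  -- A nontrivial normal subgroup of `PGL_n` has index so small that it is larger than the source of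
  -- `f`.
  have h1 := card_GL_le_card_normal hn hbot
  have h2 : Nat.card f.range ≤ Nat.card (GL (Fin (Fintype.card ι)) F) := by
    rw [← card_GL_congr]
    exact Nat.card_le_card_of_surjective _ f.rangeRestrict_surjective
  have h3 := card_GL_mul_pow_lt (F := F) hι (by omega)
  have := h1.trans (Nat.mul_le_mul_right _ h2)
  omega

theorem commute_GL_of_card_eq_one {ι : Type*} [Fintype ι] [DecidableEq ι]
    (hι : Fintype.card ι = 1) (g h : GL ι F) : Commute g h := by
  obtain ⟨x, hx⟩ := Fintype.card_eq_one_iff.1 hι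
  refine Units.ext ?_
  ext i j
  rw [hx i, hx j]
  have : (Finset.univ : Finset ι) = {x} := by ext y; simp [hx y]
  simp [Matrix.mul_apply, this, mul_comm]

variable {L : Type*} [Group L] {I : Type*} {ι : I → Type*} [∀ i, Fintype (ι i)]
  [∀ i, DecidableEq (ι i)]

/-- Let `L` map onto `PGL_n`, and let `N ≤ K` be normal in `L`, such that the image of `N` is
`p`-torsion and `K` is generated by `N` and commuting general linear groups of degrees different
from `n`, normalized by `L` modulo `N`. Then `K` has abelian image modulo `N`. -/
theorem commutator_mem_map_of_card_ne (p : ℕ) [Fact p.Prime] [CharP F p] (hn : 2 ≤ n)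
    (ψ : L →* ProjGenLinGroup (Fin n) F) (hψ : Function.Surjective ψ)
    (N K : Subgroup L) [N.Normal]
    (hN : ∀ x ∈ N, ∃ k : ℕ, ψ x ^ p ^ k = 1)
    (j : ∀ i, GL (ι i) F →* L)
    (hcomm : ∀ i i', i ≠ i' → ∀ g h, Commute (j i g) (j i' h))
    (hconj : ∀ l i g, ∃ g', l * j i g * l⁻¹ * (j i g')⁻¹ ∈ N)
    (hgen : K ≤ N ⊔ ⨆ i, (j i).range)
    (hpos : ∀ i, 0 < Fintype.card (ι i)) (hcard : ∀ i, Fintype.card (ι i) ≠ n)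
    (x y : L) (hx : x ∈ K) (hy : y ∈ K) : ψ x * ψ y * (ψ x)⁻¹ * (ψ y)⁻¹ ∈ N.map ψ := by
  have hnorm : (N.map ψ).Normal := Subgroup.Normal.map inferInstance ψ hψ
  have hNbot : 3 ≤ n → N.map ψ = ⊥ := fun h3 => eq_bot_of_normal_of_torsion p h3 (by
    rintro _ ⟨z, hz, rfl⟩
    exact hN z hz)
  have hab : ∀ i g h, Commute (ψ (j i g)) (ψ (j i h)) := by
    intro i g h
    rcases lt_or_gt_of_ne (hcard i) with hlt | hgt
    · by_cases h3 : 3 ≤ n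
      · have hr : (ψ.comp (j i)).range.Normal := by
          constructor
          rintro _ ⟨g, rfl⟩ z
          obtain ⟨l, rfl⟩ := hψ z
          obtain ⟨g', hg'⟩ := hconj l i g
          -- For `n ≥ 3` the image of `N` is trivial, so being normalized modulo `N` makes the
          -- block's image normal in `PGL_n`.
          have h4 : ψ (l * j i g * l⁻¹ * (j i g')⁻¹) ∈ N.map ψ := ⟨_, hg', rfl⟩
          rw [hNbot h3, Subgroup.mem_bot, map_mul, map_inv, mul_inv_eq_one] at h4
          exact ⟨g', by simpa using h4.symm⟩
        have e := fun g => eq_one_of_card_lt h3 hlt (ψ.comp (j i)) hr g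
        simp only [MonoidHom.comp_apply] at e
        rw [e, e]
      · have h1 : Fintype.card (ι i) = 1 := by have := hpos i; omega
        exact ((commute_GL_of_card_eq_one h1 g h).map (j i)).map ψ
    · exact commute_of_lt_card hn hgt (ψ.comp (j i)) g h
  -- Modulo the image of `N`, the image of `K` lies in a group generated by pairwise commuting
  -- elements: different blocks commute already in `L`, and each block has abelian image.
  let π := (QuotientGroup.mk' (N.map ψ)).comp ψ
  let S : Set (_ ⧸ N.map ψ) := {z | ∃ i g, z = π (j i g)}
  have hS : ∀ a ∈ S, ∀ b ∈ S, a * b = b * a := by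
    rintro _ ⟨i, g, rfl⟩ _ ⟨i', h, rfl⟩
    by_cases hii : i = i'
    · subst hii
      exact ((hab i g h).map (QuotientGroup.mk' (N.map ψ))).eq
    · exact ((hcomm i i' hii g h).map π).eq
  have hle : K.map π ≤ Subgroup.closure S := by
    refine (Subgroup.map_mono hgen).trans ?_
    rw [Subgroup.map_sup, Subgroup.map_iSup]
    refine sup_le ?_ (iSup_le fun i => ?_)
    · rintro _ ⟨z, hz, rfl⟩
      have : π z = 1 := (QuotientGroup.eq_one_iff _).2 ⟨z, hz, rfl⟩
      rw [this]
      exact one_mem _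
    · rintro _ ⟨_, ⟨g, rfl⟩, rfl⟩
      exact Subgroup.subset_closure ⟨i, g, rfl⟩
  have key : π x * π y = π y * π x := by
    have hc := Subgroup.isMulCommutative_closure hS
    have := hc.is_comm.comm ⟨π x, hle ⟨x, hx, rfl⟩⟩ ⟨π y, hle ⟨y, hy, rfl⟩⟩
    exact congrArg Subtype.val this
  rw [← QuotientGroup.ker_mk' (N.map ψ), MonoidHom.mem_ker, map_mul, map_inv, mul_inv_eq_one,
    map_mul, map_inv, mul_inv_eq_iff_eq_mul, map_mul]
  exact key

/-- Here the image of `N` is trivial, so the image of `K` is an abelian normal subgroup. If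
nontrivial, it would contain the images of all transvections, two of which do not commute. -/
theorem map_eq_one_of_card_ne (p : ℕ) [Fact p.Prime] [CharP F p] (hn : 3 ≤ n)
    (ψ : L →* ProjGenLinGroup (Fin n) F) (hψ : Function.Surjective ψ)
    (N K : Subgroup L) [N.Normal] [K.Normal]
    (hN : ∀ x ∈ N, ∃ k : ℕ, ψ x ^ p ^ k = 1)
    (j : ∀ i, GL (ι i) F →* L)
    (hcomm : ∀ i i', i ≠ i' → ∀ g h, Commute (j i g) (j i' h))
    (hconj : ∀ l i g, ∃ g', l * j i g * l⁻¹ * (j i g')⁻¹ ∈ N)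
    (hgen : K ≤ N ⊔ ⨆ i, (j i).range)
    (hpos : ∀ i, 0 < Fintype.card (ι i)) (hcard : ∀ i, Fintype.card (ι i) ≠ n)
    (x : L) (hx : x ∈ K) : ψ x = 1 := by
  have hNn : (N.map ψ).Normal := Subgroup.Normal.map inferInstance ψ hψ
  have hKn : (K.map ψ).Normal := Subgroup.Normal.map inferInstance ψ hψ
  have hNbot : N.map ψ = ⊥ := eq_bot_of_normal_of_torsion p hn (by
    rintro _ ⟨z, hz, rfl⟩
    exact hN z hz)
  suffices h : K.map ψ = ⊥ from (Subgroup.eq_bot_iff_forall _).1 h _ ⟨x, hx, rfl⟩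
  by_contra hK
  obtain ⟨a, b, hab, hnc⟩ := not_commute_mk_transvGL (F := F) hn
  obtain ⟨u, hu, eu⟩ := mk_transvGL_mem hn hK a b hab 1
  obtain ⟨v, hv, ev⟩ := mk_transvGL_mem hn hK b a hab.symm 1
  have h1 := commutator_mem_map_of_card_ne p (by omega) ψ hψ N K hN j hcomm hconj hgen hpos hcard
    u v hu hv
  rw [hNbot, Subgroup.mem_bot, mul_inv_eq_one, mul_inv_eq_iff_eq_mul, eu, ev] at h1
  exact hnc h1

end LinearQuotients

end InfMatrix

namespace InfMatrix

open Matrix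

/-! ### Restriction to finite convex sets and embedding of blocks -/

section Restriction

variable {Λ : Type*} [DecidableEq Λ] {r : Λ → Λ → Prop} [IsZLike r] {R : Type*} [CommRing R]

/-- Restriction to a finite convex set of indices. -/
noncomputable def res (t : Finset Λ) (ht : IsConvex r (t : Set Λ)) : U r R →* GL t R :=
  MonoidHom.toHomUnits
    { toFun := fun a => restrict a.1 t
      map_one' := restrict_one t
      map_mul' := fun a b => restrict_mul a.2.1 b.2.1 ht }

@[simp]
theorem coe_res (t : Finset Λ) (ht : IsConvex r (t : Set Λ)) (a : U r R) :
    (res t ht a : Matrix t t R) = restrict a.1 t := rfl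

theorem res_eq_one_iff (t : Finset Λ) (ht : IsConvex r (t : Set Λ)) (a : U r R) :
    res t ht a = 1 ↔ ∀ i ∈ t, ∀ j ∈ t, a.1 i j = (1 : Matrix Λ Λ R) i j := by
  rw [Units.ext_iff, coe_res, Units.val_one, ← restrict_one]
  constructor
  · intro h i hi j hj
    exact congrFun (congrFun h ⟨i, hi⟩) ⟨j, hj⟩
  · intro h
    ext i j
    exact h i i.2 j j.2

/-- Extension of a matrix on `s` by the identity. -/
def embMat (s : Finset Λ) (g : Matrix s s R) : Matrix Λ Λ R := fun i j =>
  if h : i ∈ s ∧ j ∈ s then g ⟨i, h.1⟩ ⟨j, h.2⟩ else (1 : Matrix Λ Λ R) i j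

theorem embMat_apply_of_mem {s : Finset Λ} (g : Matrix s s R) {i j : Λ} (hi : i ∈ s)
    (hj : j ∈ s) : embMat s g i j = g ⟨i, hi⟩ ⟨j, hj⟩ := dif_pos ⟨hi, hj⟩

theorem embMat_apply_of_notMem_left {s : Finset Λ} (g : Matrix s s R) {i j : Λ} (hi : i ∉ s) :
    embMat s g i j = (1 : Matrix Λ Λ R) i j := dif_neg fun h => hi h.1

theorem embMat_apply_of_notMem_right {s : Finset Λ} (g : Matrix s s R) {i j : Λ} (hj : j ∉ s) :
    embMat s g i j = (1 : Matrix Λ Λ R) i j := dif_neg fun h => hj h.2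

theorem embMat_one (s : Finset Λ) : embMat s (1 : Matrix s s R) = 1 := by
  ext i j
  by_cases h : i ∈ s ∧ j ∈ s
  · rw [embMat_apply_of_mem _ h.1 h.2, Matrix.one_apply, Matrix.one_apply]
    simp
  · exact dif_neg h

theorem mul_embMat_of_notMem {s : Finset Λ} (g : Matrix s s R) (b : Matrix Λ Λ R) {i : Λ}
    (hi : i ∉ s) (j : Λ) : mul (embMat s g) b i j = b i j := by
  rw [mul, finsum_eq_single _ i]
  · simp [embMat_apply_of_notMem_left g hi]
  · intro k hk
    simp [embMat_apply_of_notMem_left g hi, Matrix.one_apply_ne hk.symm]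

theorem mul_embMat_of_mem {s : Finset Λ} (g : Matrix s s R) (b : Matrix Λ Λ R) {i : Λ}
    (hi : i ∈ s) (j : Λ) : mul (embMat s g) b i j = ∑ k : s, g ⟨i, hi⟩ k * b k j := by
  rw [mul, finsum_eq_sum_of_support_subset (s := s)]
  · rw [← Finset.sum_coe_sort s]
    refine Finset.sum_congr rfl fun k _ => ?_
    rw [embMat_apply_of_mem _ hi k.2]
  · intro k hk
    by_contra hks
    refine hk ?_
    change embMat s g i k * b k j = 0
    have hne : i ≠ k := fun h => hks (h ▸ hi)
    rw [embMat_apply_of_notMem_right g hks, Matrix.one_apply_ne hne, zero_mul]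

theorem embMat_mul (s : Finset Λ) (g h : Matrix s s R) :
    mul (embMat s g) (embMat s h) = embMat s (g * h) := by
  ext i j
  by_cases hi : i ∈ s
  · rw [mul_embMat_of_mem _ _ hi]
    by_cases hj : j ∈ s
    · rw [embMat_apply_of_mem _ hi hj, Matrix.mul_apply]
      exact Finset.sum_congr rfl fun k _ => by rw [embMat_apply_of_mem _ k.2 hj]
    · have hne : i ≠ j := fun h => hj (h ▸ hi)
      rw [embMat_apply_of_notMem_right _ hj, Matrix.one_apply_ne hne]
      refine Finset.sum_eq_zero fun k _ => ?_
      have hne : (k : Λ) ≠ j := fun h => hj (h ▸ k.2)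
      rw [embMat_apply_of_notMem_right _ hj, Matrix.one_apply_ne hne, mul_zero]
  · rw [mul_embMat_of_notMem _ _ hi, embMat_apply_of_notMem_left _ hi,
      embMat_apply_of_notMem_left _ hi]

theorem mul_embMat_of_disjoint {s s' : Finset Λ} (hd : Disjoint s s') (g : Matrix s s R)
    (h : Matrix s' s' R) {i : Λ} (hi : i ∈ s) (j : Λ) :
    mul (embMat s g) (embMat s' h) i j = embMat s g i j := by
  rw [mul_embMat_of_mem _ _ hi]
  have hk : ∀ k : s, embMat s' h k j = (1 : Matrix Λ Λ R) k j := fun k =>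
    embMat_apply_of_notMem_left _ (Finset.disjoint_left.1 hd k.2)
  by_cases hj : j ∈ s
  · rw [Finset.sum_eq_single ⟨j, hj⟩, hk, embMat_apply_of_mem _ hi hj]
    · simp
    · intro k _ hkj
      rw [hk, Matrix.one_apply_ne (fun e => hkj (Subtype.ext e)), mul_zero]
    · simp
  · have hne : i ≠ j := fun h => hj (h ▸ hi)
    rw [embMat_apply_of_notMem_right _ hj, Matrix.one_apply_ne hne]
    refine Finset.sum_eq_zero fun k _ => ?_
    have hne : (k : Λ) ≠ j := fun h => hj (h ▸ k.2)
    rw [hk, Matrix.one_apply_ne hne, mul_zero]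

theorem embMat_comm {s s' : Finset Λ} (hd : Disjoint s s') (g : Matrix s s R)
    (h : Matrix s' s' R) : mul (embMat s g) (embMat s' h) = mul (embMat s' h) (embMat s g) := by
  ext i j
  by_cases hi : i ∈ s
  · rw [mul_embMat_of_disjoint hd _ _ hi, mul_embMat_of_notMem _ _ (Finset.disjoint_left.1 hd hi)]
  · rw [mul_embMat_of_notMem _ _ hi]
    by_cases hi' : i ∈ s'
    · rw [mul_embMat_of_disjoint hd.symm _ _ hi']
    · rw [mul_embMat_of_notMem _ _ hi', embMat_apply_of_notMem_left _ hi,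
        embMat_apply_of_notMem_left _ hi']

theorem embMat_upper {s : Finset Λ} (hs : ∀ i ∈ s, ∀ j ∈ s, r i j) (g : Matrix s s R) :
    IsUpperTriangular r (embMat s g) := by
  intro i j hij
  have h : ¬ (i ∈ s ∧ j ∈ s) := fun h => hij (hs i h.1 j h.2)
  rw [embMat, dif_neg h]
  exact one_upper (r := r) i j hij

theorem embMat_nonsingular {s : Finset Λ} (hs : ∀ i ∈ s, ∀ j ∈ s, r i j) (g : GL s R) :
    IsNonsingular r (embMat s g.1) := by
  refine ⟨∅, by intro i hi; simp at hi, fun t ht _ => ?_⟩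
  have h1 : restrict (embMat s g.1) t * restrict (embMat s g.2) t = 1 := by
    rw [← restrict_mul (embMat_upper hs _) (embMat_upper hs _) ht, embMat_mul]
    rw [show g.1 * g.2 = 1 from g.3, embMat_one, restrict_one]
  have h2 : restrict (embMat s g.2) t * restrict (embMat s g.1) t = 1 := by
    rw [← restrict_mul (embMat_upper hs _) (embMat_upper hs _) ht, embMat_mul]
    rw [show g.2 * g.1 = 1 from g.4, embMat_one, restrict_one]
  exact ⟨⟨_, _, h1, h2⟩, rfl⟩

/-- The general linear group of a set of equivalent indices, as a group of matrices equal to the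
identity elsewhere. -/
def emb (s : Finset Λ) (hs : ∀ i ∈ s, ∀ j ∈ s, r i j) : GL s R →* U r R where
  toFun g := ⟨embMat s g.1, embMat_upper hs _, embMat_nonsingular hs g⟩
  map_one' := Subtype.ext (embMat_one s)
  map_mul' g h := Subtype.ext (embMat_mul s g.1 h.1).symm

theorem res_emb_self (s : Finset Λ) (hs : ∀ i ∈ s, ∀ j ∈ s, r i j)
    (hc : IsConvex r (s : Set Λ)) (g : GL s R) : res s hc (emb s hs g) = g := by
  refine Units.ext ?_
  ext i j
  exact embMat_apply_of_mem _ i.2 j.2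

theorem res_emb_of_disjoint {s t : Finset Λ} (hs : ∀ i ∈ s, ∀ j ∈ s, r i j)
    (ht : IsConvex r (t : Set Λ)) (hd : Disjoint s t) (g : GL s R) :
    res t ht (emb s hs g) = 1 := by
  rw [res_eq_one_iff]
  intro i hi j _
  exact embMat_apply_of_notMem_left _ (Finset.disjoint_right.1 hd hi)

theorem emb_commute {s s' : Finset Λ} (hs : ∀ i ∈ s, ∀ j ∈ s, r i j)
    (hs' : ∀ i ∈ s', ∀ j ∈ s', r i j) (hd : Disjoint s s') (g : GL s R) (h : GL s' R) :
    Commute (emb s hs g) (emb s' hs' h) :=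
  Subtype.ext (embMat_comm hd g.1 h.1)

end Restriction

/-- `M - 1` is strictly upper triangular, hence nilpotent, and `(M - 1)^(p^k) = M^(p^k) - 1` in
characteristic `p`. The exponent `k = |ι|` is enough since `|ι| < p^|ι|`. -/
theorem exists_pow_eq_one_of_strictUpper {ι F : Type*} [Fintype ι] [LinearOrder ι] [DecidableEq ι]
    [Field F] (p : ℕ) [Fact p.Prime] [CharP F p] (M : Matrix ι ι F)
    (hM : ∀ i j, j ≤ i → M i j = (1 : Matrix ι ι F) i j) : ∃ k : ℕ, M ^ p ^ k = 1 := by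
  rcases isEmpty_or_nonempty ι with _ | _
  · exact ⟨0, Subsingleton.elim _ _⟩
  have hz : ∀ i j, j ≤ i → (M - 1) i j = 0 := fun i j h => by
    rw [Matrix.sub_apply, hM i j h, sub_self]
  have hnil : (M - 1) ^ Fintype.card ι = 0 := by
    have h1 := aeval_self_charpoly (M - 1)
    rw [charpoly_of_isUpperTriangular _ (fun i j h => hz i j (le_of_lt h))] at h1
    simpa [hz _ _ le_rfl] using h1
  refine ⟨Fintype.card ι, ?_⟩
  have h2 : (M - 1) ^ p ^ Fintype.card ι = 0 :=
    pow_eq_zero_of_le (Nat.lt_pow_self (Fact.out : p.Prime).one_lt).le hnil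
  rwa [sub_pow_char_pow_of_commute p _ (Commute.one_right M), one_pow, sub_eq_zero] at h2

/-! ### Images of congruence subgroups when no part has size `n` -/

section Partitions

namespace IntervalPartition

variable {Q : IntervalPartition}

theorem rel_of_mem {p : Set ℤ} (hp : p ∈ Q.parts) (i : ℤ) (hi : i ∈ p) (j : ℤ) (hj : j ∈ p) :
    Q.rel i j := Or.inr ⟨p, hp, hi, hj⟩

theorem isConvex_part {p : Set ℤ} (hp : p ∈ Q.parts) : IsConvex Q.rel p := by
  rintro i hi j hj k (h | ⟨q, hq, h1, h2⟩) (h' | ⟨q', hq', h1', h2'⟩)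
  · obtain ⟨m, n, rfl⟩ := Q.isInterval p hp
    simp only [Set.mem_Icc] at *
    omega
  · rwa [part_eq hp hq' hj h2']
  · rwa [part_eq hp hq hi h1]
  · rwa [part_eq hp hq hi h1]

/-- Elements of a part are equivalent, so each of them lies between `x` and `x`. Thus a part is
either disjoint from a convex set or contained in it. -/
theorem subset_of_mem {p C : Set ℤ} (hp : p ∈ Q.parts) (hC : IsConvex Q.rel C) {x : ℤ}
    (hx : x ∈ p) (hxC : x ∈ C) : p ⊆ C := fun y hy =>
  hC x hxC x hxC y (rel_of_mem hp x hx y hy) (rel_of_mem hp y hy x hx)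

theorem finite_part {p : Set ℤ} (hp : p ∈ Q.parts) : p.Finite := by
  obtain ⟨m, n, rfl⟩ := Q.isInterval p hp
  exact Set.finite_Icc m n

theorem mem_sizes_iff {n : ℕ} : n ∈ Q.sizes ↔ ∃ p : Finset ℤ, (p : Set ℤ) ∈ Q.parts ∧ p.card = n := by
  constructor
  · rintro ⟨p, hp, rfl⟩
    exact ⟨(finite_part hp).toFinset, by simpa using hp, (Set.ncard_eq_toFinset_card p _).symm⟩
  · rintro ⟨p, hp, rfl⟩
    exact ⟨p, hp, Set.ncard_coe_finset p⟩

theorem nonempty_part {p : Finset ℤ} (hp : (p : Set ℤ) ∈ Q.parts) : p.Nonempty := by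
  rw [Finset.nonempty_iff_ne_empty]
  rintro rfl
  exact Q.isPartition.1 (by simpa using hp)

theorem disjoint_part {p q : Finset ℤ} (hp : (p : Set ℤ) ∈ Q.parts) (hq : (q : Set ℤ) ∈ Q.parts)
    (h : p ≠ q) : Disjoint p q := by
  rw [Finset.disjoint_left]
  intro x hx hx'
  exact h (Finset.coe_injective (part_eq hp hq hx hx'))

end IntervalPartition

open IntervalPartition

variable {F : Type*} [Field F] [Finite F] {Q : IntervalPartition} {n : ℕ}

/-- If an open subgroup `L` of `U_Q` maps onto `PGL_n` and `n` is not the size of a part of `Q`,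
then each subgroup of `L` of the form `ker (res C)` has image with `p`-torsion commutators, and
trivial image if `n ≥ 3`. -/
theorem image_of_notMem_sizes (p : ℕ) [Fact p.Prime] [CharP F p] (hn : 2 ≤ n)
    (hsz : n ∉ Q.sizes) {C D : Finset ℤ}
    (hC : IsConvex Q.rel (C : Set ℤ)) (hD : IsConvex Q.rel (D : Set ℤ))
    (L : Subgroup (U Q.rel F)) (hL : (res C hC).ker ≤ L)
    (ψ : L →* ProjGenLinGroup (Fin n) F) (hψ : Function.Surjective ψ)
    (hker : ∀ g : L, res D hD g.1 = 1 → ψ g = 1) :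
    (∀ x y : L, res C hC x.1 = 1 → res C hC y.1 = 1 →
      ∃ k : ℕ, (ψ x * ψ y * (ψ x)⁻¹ * (ψ y)⁻¹) ^ p ^ k = 1) ∧
    (3 ≤ n → ∀ x : L, res C hC x.1 = 1 → ψ x = 1) := by
  classical
  let I := {q : Finset ℤ // (q : Set ℤ) ∈ Q.parts ∧ q ⊆ D ∧ Disjoint q C}
  have hIfin : Finite I :=
    Finite.of_injective (fun q : I => (⟨q.1, Finset.mem_powerset.2 q.2.2.1⟩ : D.powerset))
      fun a b h => Subtype.ext (congrArg (fun z : D.powerset => z.1) h)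
  have hc : ∀ q : I, IsConvex Q.rel (q.1 : Set ℤ) := fun q => isConvex_part q.2.1
  -- Every part meeting `D` lies in `D`, and it is contained in `C` or belongs to `I`. Hence
  -- elements of `N₀` are unitriangular on `D`, which is all that `ψ` sees.
  let N₀ : Subgroup (U Q.rel F) := (res C hC).ker ⊓ ⨅ q : I, (res q.1 (hc q)).ker
  have hN₀ : ∀ g, g ∈ N₀ ↔ res C hC g = 1 ∧ ∀ q : I, res q.1 (hc q) g = 1 := by
    intro g
    simp only [N₀, Subgroup.mem_inf, Subgroup.mem_iInf, MonoidHom.mem_ker]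
  have : N₀.Normal := by
    constructor
    intro g hg u
    rw [hN₀] at hg ⊢
    exact ⟨by simp [hg.1], fun q => by simp [hg.2 q]⟩
  let N : Subgroup L := N₀.subgroupOf L
  let K : Subgroup L := (res C hC).ker.subgroupOf L
  have hresC : ∀ (q : I) (g : GL q.1 F), res C hC (emb q.1 (rel_of_mem q.2.1) g) = 1 :=
    fun q g => res_emb_of_disjoint _ hC q.2.2.2 g
  have hresI : ∀ (q q' : I) (_ : q ≠ q') (g : GL q.1 F),
      res q'.1 (hc q') (emb q.1 (rel_of_mem q.2.1) g) = 1 := fun q q' hqq g =>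
    res_emb_of_disjoint _ _ (disjoint_part q.2.1 q'.2.1 fun h => hqq (Subtype.ext h)) g
  let j : ∀ q : I, GL q.1 F →* L := fun q =>
    (emb q.1 (rel_of_mem q.2.1)).codRestrict L fun g => hL (hresC q g)
  have hN : ∀ x ∈ N, ∃ k : ℕ, ψ x ^ p ^ k = 1 := by
    intro x hx
    have hx' := (hN₀ _).1 (Subgroup.mem_subgroupOf.1 hx)
    obtain ⟨k, hk⟩ := exists_pow_eq_one_of_strictUpper p (restrict x.1.1 D) (by
      intro i l hli
      change x.1.1 i l = _
      rw [← restrict_one]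
      change x.1.1 i l = (1 : Matrix ℤ ℤ F) i l
      by_cases hil : Q.rel i l
      · have hil' : ∃ q ∈ Q.parts, (i : ℤ) ∈ q ∧ (l : ℤ) ∈ q := by
          rcases hil with h | h
          · exact absurd hli (not_le.2 h)
          · exact h
        obtain ⟨q, hq, hiq, hlq⟩ := hil'
        obtain ⟨q, rfl⟩ := (finite_part hq).exists_finset_coe
        by_cases hqC : Disjoint q C
        · exact (res_eq_one_iff _ (isConvex_part hq) x.1).1
            (hx'.2 ⟨q, hq, subset_of_mem hq hD hiq i.2, hqC⟩) i hiq l hlq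
        · obtain ⟨y, hyq, hyC⟩ := Finset.not_disjoint_iff.1 hqC
          have hs := subset_of_mem hq hC hyq hyC
          exact (res_eq_one_iff _ hC x.1).1 hx'.1 i (hs hiq) l (hs hlq)
      · rw [x.1.2.1 i l hil, one_upper (r := Q.rel) (i : ℤ) l hil])
    refine ⟨k, ?_⟩
    rw [← map_pow]
    apply hker
    rw [Subgroup.coe_pow, map_pow]
    exact Units.ext hk
  have hcomm : ∀ i i' : I, i ≠ i' → ∀ g h, Commute (j i g) (j i' h) := fun i i' hii g h =>
    Subtype.ext (emb_commute _ _ (disjoint_part i.2.1 i'.2.1 fun h => hii (Subtype.ext h)) g h)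
  have hconj : ∀ l q g, ∃ g', l * j q g * l⁻¹ * (j q g')⁻¹ ∈ N := by
    intro l q g
    -- Conjugate by the diagonal block of `l`: the quotient of the two conjugates is then trivial on
    -- `C` and on every block of `I`.
    refine ⟨res q.1 (hc q) l.1 * g * (res q.1 (hc q) l.1)⁻¹, ?_⟩
    rw [Subgroup.mem_subgroupOf, hN₀]
    constructor
    · simp [j, hresC]
    · intro q'
      by_cases hqq : q = q'
      · subst hqq
        simp [j, res_emb_self]
      · simp [j, hresI q q' hqq]
  have hgen : K ≤ N ⊔ ⨆ q, (j q).range := by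
    -- Strip off the nontrivial diagonal blocks of `x` one at a time; what remains lies in `N`.
    have key : ∀ (S : Finset I) (x : L), x ∈ K →
        (∀ q : I, q ∉ S → res q.1 (hc q) x.1 = 1) → x ∈ N ⊔ ⨆ q, (j q).range := by
      intro S
      induction S using Finset.induction_on with
      | empty =>
        intro x hx h
        refine Subgroup.mem_sup_left ?_
        exact Subgroup.mem_subgroupOf.2 ((hN₀ _).2 ⟨hx, fun q => h q (Finset.notMem_empty q)⟩)
      | insert q S hqS ih =>
        intro x hx h
        let u := j q (res q.1 (hc q) x.1)
        have hu : u ∈ N ⊔ ⨆ q, (j q).range :=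
          Subgroup.mem_sup_right (Subgroup.mem_iSup_of_mem q ⟨_, rfl⟩)
        have hxu : x * u⁻¹ ∈ N ⊔ ⨆ q, (j q).range := by
          refine ih _ (K.mul_mem hx (K.inv_mem (hresC q _))) fun q' hq' => ?_
          rw [Subgroup.coe_mul, Subgroup.coe_inv, map_mul, map_inv, mul_inv_eq_one]
          by_cases hqq : q = q'
          · subst hqq
            exact (res_emb_self _ _ (hc q) _).symm
          · rw [h q' (by simp [hq', Ne.symm hqq])]
            exact (hresI q q' hqq _).symm
        simpa using mul_mem hxu hu
    have := Fintype.ofFinite I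
    exact fun x hx => key Finset.univ x hx fun q hq => absurd (Finset.mem_univ q) hq
  have hpos : ∀ q : I, 0 < Fintype.card q.1 := fun q => by
    rw [Fintype.card_coe]
    exact (nonempty_part q.2.1).card_pos
  have hcard : ∀ q : I, Fintype.card q.1 ≠ n := fun q h => hsz (mem_sizes_iff.2 ⟨q.1, q.2.1, by
    rwa [Fintype.card_coe] at h⟩)
  refine ⟨fun x y hx hy => ?_, fun hn3 x hx => ?_⟩
  · obtain ⟨z, hz, e⟩ := commutator_mem_map_of_card_ne p hn ψ hψ N K hN j hcomm hconj hgen hpos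
      hcard x y hx hy
    rw [← e]
    exact hN z hz
  · exact map_eq_one_of_card_ne p hn3 ψ hψ N K hN j hcomm hconj hgen hpos hcard x hx

end Partitions

end InfMatrix

namespace InfMatrix

open Matrix Topology

/-! ### The topologies of `U` and `AU` -/

section Topology

variable {Λ : Type*} [DecidableEq Λ] {r : Λ → Λ → Prop} [IsZLike r] {R : Type*} [CommRing R]
  [TopologicalSpace R] [DiscreteTopology R]

theorem continuous_entry (i j : Λ) : Continuous fun a : U r R => a.1 i j :=
  (continuous_apply_apply i j).comp continuous_induced_dom

theorem isOpen_ker_res (t : Finset Λ) (ht : IsConvex r (t : Set Λ)) :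
    IsOpen ((res t ht : U r R →* GL t R).ker : Set (U r R)) := by
  have : ((res t ht : U r R →* GL t R).ker : Set (U r R)) =
      ⋂ x ∈ t ×ˢ t, (fun a : U r R => a.1 x.1 x.2) ⁻¹' {(1 : Matrix Λ Λ R) x.1 x.2} := by
    ext a
    simp only [SetLike.mem_coe, MonoidHom.mem_ker, res_eq_one_iff, Set.mem_iInter, Set.mem_preimage,
      Set.mem_singleton_iff, Finset.mem_product, Prod.forall]
    exact ⟨fun h i j hij => h i hij.1 j hij.2, fun h i hi j hj => h i j ⟨hi, hj⟩⟩
  rw [this]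
  exact isOpen_biInter_finset fun x _ =>
    (isOpen_discrete _).preimage (continuous_entry x.1 x.2)

/-- A basic neighbourhood restricts finitely many rows, and finitely many entries of each; some
finite convex set contains all indices involved. So the congruence subgroups form a neighbourhood
basis at the identity. -/
theorem exists_ker_res_subset {S : Set (U r R)} (hS : IsOpen S) (h1 : (1 : U r R) ∈ S) :
    ∃ (t : Finset Λ) (ht : IsConvex r (t : Set Λ)), ((res t ht : U r R →* GL t R).ker : Set (U r R)) ⊆ S := by
  obtain ⟨O, hO, rfl⟩ := isOpen_induced_iff.1 hS
  obtain ⟨I, u, hu, hIu⟩ := isOpen_pi_iff.1 hO _ h1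
  have hrow : ∀ i : I, ∃ J : Finset Λ, ∀ f : Λ → R,
      (∀ j ∈ J, f j = (1 : Matrix Λ Λ R) i j) → f ∈ u i := by
    intro i
    obtain ⟨J, v, hv, hJv⟩ := isOpen_pi_iff.1 (hu i i.2).1 _ (hu i i.2).2
    refine ⟨J, fun f hf => hJv fun j hj => ?_⟩
    rw [hf j hj]
    exact (hv j hj).2
  choose J hJ using hrow
  obtain ⟨t, ht, hc⟩ := exists_convex r (I ∪ Finset.univ.biUnion J)
  refine ⟨t, hc, fun a ha => hIu fun i hi => hJ ⟨i, hi⟩ _ fun j hj => ?_⟩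
  refine (res_eq_one_iff t hc a).1 ha i (ht (Finset.mem_union_left _ hi)) j
    (ht (Finset.mem_union_right _ ?_))
  exact Finset.mem_biUnion.2 ⟨⟨i, hi⟩, Finset.mem_univ _, hj⟩

/-- All new relations stay inside a finite strongly convex set containing `s`. Hence finitely many
vanishing entries cut `U_Λ` out of `U_{Λ+s}`, making it open in the direct limit. -/
theorem finite_adjoin_diff (r : Λ → Λ → Prop) [IsZLike r] (s : Finset Λ) :
    {x : Λ × Λ | ¬ r x.1 x.2 ∧ adjoin r (s : Set Λ) x.1 x.2}.Finite := by
  obtain ⟨t, ht, hc⟩ := IsZLike.exists_stronglyConvex (r := r) s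
  refine (t ×ˢ t).finite_toSet.subset ?_
  rintro ⟨i, j⟩ ⟨hij, h⟩
  rcases (adjoin_iff r _ _ _).1 h with h | ⟨x, hx, y, hy, h1, h2⟩
  · exact absurd h hij
  · simp only [Finset.coe_product, Set.mem_prod, Finset.mem_coe]
    constructor
    · by_contra hi
      rcases hc i hi with h | h
      · exact hij (trans_of r (h y (ht hy)).1 h2)
      · exact (h x (ht hx)).2 ⟨(h x (ht hx)).1, h1⟩
    · by_contra hj
      rcases hc j hj with h | h
      · exact (h y (ht hy)).2 ⟨(h y (ht hy)).1, h2⟩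
      · exact hij (trans_of r h1 (h x (ht hx)).1)

/-- The inclusion of `U_Λ(R)` in `AU_Λ(R)`. -/
def toAU : U r R →* AU r R where
  toFun a := ⟨a.1, Set.finite_empty.subset fun x hx => hx.2 (a.2.1 x.1 x.2 hx.1), a.2.2⟩
  map_one' := rfl
  map_mul' _ _ := rfl

theorem toAU_injective : Function.Injective (toAU : U r R → AU r R) := fun _ _ h =>
  Subtype.ext (congrArg (fun x : AU r R => x.1) h)

theorem isOpen_AU_iff {S : Set (AU r R)} :
    IsOpen S ↔ ∀ s : {s : Finset Λ // IsConvex r (s : Set Λ)}, IsOpen (inclusion r s.1 ⁻¹' S) := by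
  rw [isOpen_iSup_iff]
  exact forall_congr' fun s => isOpen_coinduced

theorem continuous_toAU : Continuous (toAU : U r R → AU r R) := by
  rw [continuous_def]
  intro S hS
  -- The group `U_Λ` is the stage of the direct limit at the empty set.
  have h0 := isOpen_AU_iff.1 hS ⟨∅, by intro i hi; simp at hi⟩
  let c : U r R → U (adjoin r ((∅ : Finset Λ) : Set Λ)) R := fun a =>
    ⟨a.1, fun i j h => a.2.1 i j fun h' => h (.single (Or.inl h')), nonsingular_adjoin ∅ a.2.2⟩
  have hc : Continuous c := continuous_induced_rng.2 continuous_induced_dom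
  exact h0.preimage hc

theorem isOpenMap_toAU : IsOpenMap (toAU : U r R → AU r R) := by
  intro S hS
  obtain ⟨O, hO, rfl⟩ := isOpen_induced_iff.1 hS
  refine isOpen_AU_iff.2 fun s => ?_
  have : inclusion r s.1 ⁻¹' (toAU '' (Subtype.val ⁻¹' O : Set (U r R))) =
      ({a | a.1 ∈ O} : Set (U (adjoin r (s.1 : Set Λ)) R)) ∩ ⋂ x ∈ (finite_adjoin_diff r s.1).toFinset,
        (fun a : U (adjoin r (s.1 : Set Λ)) R => a.1 x.1 x.2) ⁻¹' {0} := by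
    ext a
    simp only [Set.mem_preimage, Set.mem_image, Set.mem_inter_iff, Set.mem_iInter,
      Set.Finite.mem_toFinset, Set.mem_ofPred_eq, Set.mem_singleton_iff]
    constructor
    · rintro ⟨b, hb, e⟩
      have e' : b.1 = a.1 := congrArg (fun x : AU r R => x.1) e
      rw [← e']
      exact ⟨hb, fun x hx => b.2.1 x.1 x.2 hx.1⟩
    · rintro ⟨ha, hz⟩
      refine ⟨⟨a.1, fun i j hij => ?_, (almostUpper_of_adjoin s.1 a.2.1 a.2.2).2⟩, ha, rfl⟩
      by_cases h : adjoin r (s.1 : Set Λ) i j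
      · exact hz (i, j) ⟨hij, h⟩
      · exact a.2.1 i j h
  rw [this]
  have := adjoin_isZLike r s.1
  exact (hO.preimage continuous_induced_dom).inter (isOpen_biInter_finset fun x _ =>
    (isOpen_discrete _).preimage (continuous_entry x.1 x.2))

theorem isOpenEmbedding_toAU : IsOpenEmbedding (toAU : U r R → AU r R) :=
  .of_continuous_injective_isOpenMap continuous_toAU toAU_injective isOpenMap_toAU

instance {n : Type*} [Fintype n] [DecidableEq n] : DiscreteTopology (ProjGenLinGroup n R) := by
  have : DiscreteTopology (Matrix n n R) := inferInstanceAs (DiscreteTopology (n → n → R))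
  refine discreteTopology_iff_forall_isOpen.2 fun S => isOpen_coinduced.2 (isOpen_discrete _)

end Topology

/-! ### The two assertions of the theorem -/

section Main

open IntervalPartition

variable {F : Type*} [Field F] [Finite F] [TopologicalSpace F] [DiscreteTopology F]

/-- The map to `PGL_n` given by the block of a part of size `n`. -/
noncomputable def blockPGL {Q : IntervalPartition} {n : ℕ} {q : Finset ℤ}
    (hq : (q : Set ℤ) ∈ Q.parts) (hn : q.card = n) :
    U Q.rel F →* ProjGenLinGroup (Fin n) F :=
  (ProjGenLinGroup.mk.comp (Units.mapEquiv (reindexAlgEquiv F F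
    (q.equivFinOfCardEq hn)).toRingEquiv.toMulEquiv).toMonoidHom).comp (res q (isConvex_part hq))

theorem blockPGL_eq_one {Q : IntervalPartition} {n : ℕ} {q : Finset ℤ}
    (hq : (q : Set ℤ) ∈ Q.parts) (hn : q.card = n) {a : U Q.rel F}
    (ha : res q (isConvex_part hq) a = 1) : blockPGL hq hn a = 1 := by
  rw [blockPGL, MonoidHom.comp_apply, ha, map_one]

theorem exists_blockPGL_emb_eq {Q : IntervalPartition} {n : ℕ} {q : Finset ℤ}
    (hq : (q : Set ℤ) ∈ Q.parts) (hn : q.card = n) (x : ProjGenLinGroup (Fin n) F) :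
    ∃ g : GL q F, blockPGL hq hn (emb q (rel_of_mem hq) g) = x := by
  obtain ⟨y, rfl⟩ := ProjGenLinGroup.mk_surjective x
  let e := Units.mapEquiv (reindexAlgEquiv F F
    (q.equivFinOfCardEq hn)).toRingEquiv.toMulEquiv
  refine ⟨e.symm y, ?_⟩
  rw [blockPGL, MonoidHom.comp_apply, res_emb_self, MonoidHom.comp_apply]
  exact congrArg _ (e.apply_symm_apply y)

/-- Continuity into a discrete group provides the window `D`. Taking `C` empty and `L` the whole
group, `image_of_notMem_sizes` would make `PGL_n` trivial, or for `n = 2` make all its commutators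
`p`-torsion. -/
theorem mem_sizes_of_surjective {Q : IntervalPartition} {n : ℕ} (hn : 1 < n)
    (φ : U Q.rel F →* ProjGenLinGroup (Fin n) F) (hφ : Continuous φ)
    (hsurj : Function.Surjective φ) : n ∈ Q.sizes := by
  by_contra hsz
  obtain ⟨p, hp⟩ := CharP.exists F
  have hpp : Fact p.Prime := ⟨CharP.char_is_prime F p⟩
  obtain ⟨D, hD, hDφ⟩ := exists_ker_res_subset ((isOpen_discrete {1}).preimage hφ) (map_one φ)
  have hC : IsConvex Q.rel ((∅ : Finset ℤ) : Set ℤ) := by intro i hi; simp at hi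
  have htriv : ∀ x : (⊤ : Subgroup (U Q.rel F)), res ∅ hC x.1 = 1 := fun x =>
    (res_eq_one_iff _ _ _).2 fun i hi => absurd hi (Finset.notMem_empty i)
  have hs : Function.Surjective (φ.comp (Subgroup.subtype ⊤)) := fun x => by
    obtain ⟨y, rfl⟩ := hsurj x
    exact ⟨⟨y, Subgroup.mem_top y⟩, rfl⟩
  obtain ⟨h2, h3⟩ := image_of_notMem_sizes p hn hsz hC hD ⊤ le_top (φ.comp (Subgroup.subtype ⊤))
    hs (fun g hg => hDφ hg)
  by_cases hn3 : 3 ≤ n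
  · obtain ⟨i, j, hij, hnc⟩ := not_commute_mk_transvGL (F := F) hn3
    apply hnc
    obtain ⟨x, hx⟩ := hs (ProjGenLinGroup.mk (transvGL i j hij 1))
    rw [← hx, h3 hn3 x (htriv x)]
    exact Commute.one_left _
  · obtain rfl : n = 2 := by omega
    obtain ⟨a, b, hab⟩ := exists_commutator_not_torsion (F := F) p
    obtain ⟨x, rfl⟩ := hs a
    obtain ⟨y, rfl⟩ := hs b
    obtain ⟨k, hk⟩ := h2 x y (htriv x) (htriv y)
    exact hab k hk

theorem exists_surjective_of_mem_sizes {Q : IntervalPartition} {n : ℕ} (h : n ∈ Q.sizes) :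
    ∃ φ : U Q.rel F →* ProjGenLinGroup (Fin n) F, Continuous φ ∧ Function.Surjective φ := by
  obtain ⟨q, hq, hn⟩ := mem_sizes_iff.1 h
  refine ⟨blockPGL hq hn, ?_, fun x => ?_⟩
  · rw [continuous_def]
    intro S _
    rw [isOpen_iff_forall_mem_open]
    intro a ha
    refine ⟨{b | ∀ x ∈ q ×ˢ q, b.1 x.1 x.2 = a.1 x.1 x.2}, ?_, ?_, fun _ _ => rfl⟩
    · intro b hb
      have : res q (isConvex_part hq) b = res q (isConvex_part hq) a := by
        refine Units.ext ?_
        ext i j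
        exact hb (i, j) (Finset.mem_product.2 ⟨i.2, j.2⟩)
      rw [Set.mem_preimage, blockPGL, MonoidHom.comp_apply, this]
      exact ha
    · simp only [Set.ofPred_forall]
      exact isOpen_biInter_finset fun x _ =>
        (isOpen_discrete {a.1 x.1 x.2}).preimage (continuous_entry x.1 x.2)
  · obtain ⟨g, hg⟩ := exists_blockPGL_emb_eq hq hn x
    exact ⟨_, hg⟩

/-- Transport the block map of a large part of `Q₂` along `e`. The sets `C` and `D` are fixed before
`n`, so factoring through restriction to `C` bounds the order of `PGL_n`. -/
theorem finite_sizes_diff {Q₁ Q₂ : IntervalPartition} (W₁ : Subgroup (U Q₁.rel F))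
    (W₂ : Subgroup (U Q₂.rel F)) (h₁ : IsOpen (W₁ : Set (U Q₁.rel F)))
    (h₂ : IsOpen (W₂ : Set (U Q₂.rel F))) (e : W₁ ≃* W₂) (he : Continuous e) :
    (Q₂.sizes \ Q₁.sizes).Finite := by
  obtain ⟨p, hp⟩ := CharP.exists F
  have hpp : Fact p.Prime := ⟨CharP.char_is_prime F p⟩
  obtain ⟨D, hD, hDW⟩ := exists_ker_res_subset h₂ W₂.one_mem
  have hopen : ∀ A : Subgroup (U Q₂.rel F), IsOpen (A : Set (U Q₂.rel F)) →
      IsOpen ((((A.subgroupOf W₂).comap e.toMonoidHom).map W₁.subtype : Subgroup _) :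
        Set (U Q₁.rel F)) := by
    intro A hA
    refine h₁.isOpenMap_subtype_val _ ?_
    exact (hA.preimage continuous_subtype_val).preimage he
  let L : Subgroup (U Q₁.rel F) :=
    (((res D hD).ker.subgroupOf W₂).comap e.toMonoidHom).map W₁.subtype
  have hLW : L ≤ W₁ := Subgroup.map_subtype_le _
  have hLmem : ∀ w : W₁, res D hD (e w).1 = 1 → w.1 ∈ L := fun w hw => ⟨w, hw, rfl⟩
  obtain ⟨C, hC, hCL⟩ := exists_ker_res_subset (hopen _ (isOpen_ker_res D hD)) (one_mem _)
  -- Beyond this bound, `n ≥ 3`, a part of size `n` does not fit into `D` and so misses it, and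
  -- `PGL_n` has more elements than `GL C F`.
  refine (Set.finite_le_nat (max 2 (max D.card (Nat.card (GL C F))))).subset ?_
  rintro n ⟨hn₂, hn₁⟩
  by_contra hlt
  simp only [Set.mem_ofPred_eq, not_le, max_lt_iff] at hlt
  obtain ⟨hn2, hnD, hnC⟩ := hlt
  obtain ⟨q, hq, hqn⟩ := mem_sizes_iff.1 hn₂
  have hqD : Disjoint q D := by
    by_contra hnd
    obtain ⟨y, hyq, hyD⟩ := Finset.not_disjoint_iff.1 hnd
    have := Finset.card_le_card (subset_of_mem hq hD hyq hyD : q ⊆ D)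
    omega
  let ψ : L →* ProjGenLinGroup (Fin n) F :=
    (blockPGL hq hqn).comp (W₂.subtype.comp (e.toMonoidHom.comp (Subgroup.inclusion hLW)))
  have hψ : Function.Surjective ψ := by
    intro x
    obtain ⟨g, hg⟩ := exists_blockPGL_emb_eq hq hqn x
    have hgD := res_emb_of_disjoint (rel_of_mem hq) hD hqD g
    let w : W₂ := ⟨_, hDW hgD⟩
    refine ⟨⟨(e.symm w).1, hLmem _ (by rw [e.apply_symm_apply]; exact hgD)⟩, ?_⟩
    change blockPGL hq hqn (e (e.symm w)).1 = x
    rw [e.apply_symm_apply]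
    exact hg
  obtain ⟨E, hE, hEq⟩ := exists_ker_res_subset
    (hopen _ (isOpen_ker_res q (isConvex_part hq))) (one_mem _)
  have hker : ∀ g : L, res E hE g.1 = 1 → ψ g = 1 := by
    intro g hg
    obtain ⟨w, hw, hwg⟩ := hEq hg
    have : Subgroup.inclusion hLW g = w := Subtype.ext hwg.symm
    change blockPGL hq hqn (e (Subgroup.inclusion hLW g)).1 = 1
    rw [this]
    exact blockPGL_eq_one hq hqn hw
  have key := (image_of_notMem_sizes p (by omega) hn₁ hC hE L hCL ψ hψ hker).2 (by omega)
  have hle : Nat.card (ProjGenLinGroup (Fin n) F) ≤ Nat.card (GL C F) := by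
    -- Elements of `L` with equal restrictions to `C` have equal images, so a section of `ψ`
    -- followed by restriction to `C` is injective.
    choose s hs using hψ
    refine Nat.card_le_card_of_injective (fun x => res C hC (s x).1) fun x y hxy => ?_
    have := key (s x * (s y)⁻¹) (by
      rw [Subgroup.coe_mul, Subgroup.coe_inv, map_mul, map_inv, mul_inv_eq_one]
      exact hxy)
    rwa [map_mul, map_inv, mul_inv_eq_one, hs, hs] at this
  have := le_card_PGL (F := F) n
  omega

/-- As both groups `U` are open in `AU`, a small congruence subgroup `W` of the first lies in `V`
and is mapped by `φ` into the second. Being closed under products, `W` carries an honest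
homomorphism, an isomorphism onto an open subgroup that is continuous both ways, so
`finite_sizes_diff` applies in both directions. -/
theorem finite_symmDiff_sizes {Q₁ Q₂ : IntervalPartition}
    (h : LocallyIsomorphic (AU Q₁.rel F) (AU Q₂.rel F)) : (symmDiff Q₁.sizes Q₂.sizes).Finite := by
  obtain ⟨V, φ, hV, h1V, hφ, hmul, -⟩ := h
  have hφ1 : φ ⟨1, h1V⟩ = 1 := by
    have := hmul ⟨1, h1V⟩ ⟨1, h1V⟩ (by simpa using h1V)
    simpa using this
  have hSopen : IsOpen (toAU ⁻¹' (Subtype.val '' (φ ⁻¹' Set.range (toAU (r := Q₂.rel) (R := F))) :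
      Set (AU Q₁.rel F)) : Set (U Q₁.rel F)) :=
    (hV.isOpenMap_subtype_val _ (isOpenEmbedding_toAU.isOpen_range.preimage hφ.continuous)).preimage
      continuous_toAU
  obtain ⟨C, hC, hCS⟩ := exists_ker_res_subset hSopen
    ⟨⟨1, h1V⟩, ⟨1, by rw [map_one, hφ1]⟩, by rw [map_one]⟩
  let W : Subgroup (U Q₁.rel F) := (res C hC).ker
  have hWopen : IsOpen (W : Set (U Q₁.rel F)) := isOpen_ker_res C hC
  have hWV : ∀ w : W, toAU w.1 ∈ V := fun w => by
    obtain ⟨v, -, hv⟩ := hCS w.2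
    exact hv ▸ v.2
  let κ : W → V := fun w => ⟨toAU w.1, hWV w⟩
  have hκ : IsOpenEmbedding κ := by
    refine IsOpenEmbedding.of_comp κ hV.isOpenEmbedding_subtypeVal ?_
    exact isOpenEmbedding_toAU.comp hWopen.isOpenEmbedding_subtypeVal
  have hex : ∀ w : W, ∃ y : U Q₂.rel F, toAU y = φ (κ w) := fun w => by
    obtain ⟨v, ⟨y, hy⟩, hv⟩ := hCS w.2
    refine ⟨y, ?_⟩
    rw [hy]
    congr 1
    exact Subtype.ext hv
  choose θ₀ hθ₀ using hex
  let θ : W →* U Q₂.rel F := MonoidHom.mk' θ₀ fun a b => toAU_injective (by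
    rw [map_mul, hθ₀, hθ₀, hθ₀, ← hmul (κ a) (κ b) (by
      have := hWV (a * b)
      rwa [Subgroup.coe_mul, map_mul] at this)]
    congr 1)
  have hθ : IsOpenEmbedding θ := by
    refine IsOpenEmbedding.of_comp θ isOpenEmbedding_toAU ?_
    have : toAU ∘ θ = φ ∘ κ := funext hθ₀
    rw [this]
    exact hφ.comp hκ
  let e : W ≃* θ.range := MonoidHom.ofInjective hθ.injective
  have hrange : IsOpen (θ.range : Set (U Q₂.rel F)) := hθ.isOpen_range
  have he : Continuous e := continuous_induced_rng.2 hθ.continuous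
  have he' : Continuous e.symm := by
    rw [continuous_def]
    intro O hO
    refine isOpen_induced_iff.2 ⟨θ '' O, hθ.isOpenMap O hO, ?_⟩
    ext y
    obtain ⟨x, rfl⟩ := e.surjective y
    rw [Set.mem_preimage, Set.mem_preimage, e.symm_apply_apply]
    exact hθ.injective.mem_set_image
  exact (finite_sizes_diff θ.range W hrange hWopen e.symm he').union
    (finite_sizes_diff W θ.range hWopen hrange e he)

end Main

end InfMatrix

theorem mainTheorem3 {F : Type*} [Field F] [Finite F] [TopologicalSpace F] [DiscreteTopology F] :
    (∀ (Q : InfMatrix.IntervalPartition) (n : ℕ), 1 < n → (Nat.card F = 3 → 2 < n) →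
      ((∃ φ : InfMatrix.U Q.rel F →* Matrix.ProjGenLinGroup (Fin n) F,
          Continuous φ ∧ Function.Surjective φ) ↔ n ∈ Q.sizes)) ∧
    (∀ Q₁ Q₂ : InfMatrix.IntervalPartition,
      InfMatrix.LocallyIsomorphic (InfMatrix.AU Q₁.rel F) (InfMatrix.AU Q₂.rel F) →
        (symmDiff Q₁.sizes Q₂.sizes).Finite) :=
  ⟨fun _ _ hn _ => ⟨fun ⟨φ, hφ, hs⟩ => InfMatrix.mem_sizes_of_surjective hn φ hφ hs,
    InfMatrix.exists_surjective_of_mem_sizes⟩, fun _ _ => InfMatrix.finite_symmDiff_sizes⟩
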